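/- Let $M$ be a smooth $n$-manifold and let $F=\alpha+\beta$ be a Randers metric on $M$: $\alpha=\sqrt{a_{ij}(x)y^iy^j}$ is a smooth Riemannian metric and $\beta=b_i(x)y^i$ is a smooth 1-form with $\|\beta\|_\alpha(x)=\sup_{y\neq 0}\beta(y)/\alpha(y)<1$ for every $x\in M$. For a Finsler metric $L$ on $M$ put, in local coordinates and for $y\ne0$, $$g_{ij}=\tfrac12[L^2]_{y^iy^j},\qquad G^i=\tfrac14 g^{il}\Big\{2\frac{\partial g_{jl}}{\partial x^k}-\frac{\partial g_{jk}}{\partial x^l}\Big\}y^jy^k,\qquad \sigma_L(x)=\frac{\mathrm{Vol}(\mathbb B^n(1))}{\mathrm{Vol}\{y\in\mathbb R^n : L(x,y)<1\}},$$ $$\mathbf S=\frac{\partial G^i}{\partial y^i}-y^i\frac{\partial}{\partial x^i}\ln\sigma_L,\qquad R^i_{\ k}=2\frac{\partial G^i}{\partial x^k}-y^j\frac{\partial^2G^i}{\partial x^j\partial y^k}+2G^j\frac{\partial^2G^i}{\partial y^j\partial y^k}-\frac{\partial G^i}{\partial y^j}\frac{\partial G^j}{\partial y^k},\qquad \mathbf{Ric}=R^i_{\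 i}.$$ Let $\mathbf S$ and $\mathbf{Ric}$ denote these quantities for $L=F$, and let $\overline{\mathbf{Ric}}$ denote the Ricci curvature for $L=\alpha$. Let $_{|}$ denote covariant differentiation with respect to the Levi-Civita connection of $\alpha$, and set $$s_{ij}=\tfrac12(b_{i|j}-b_{j|i}),\qquad s^i_{\ j}=a^{ik}s_{kj},\qquad s_j=b_is^i_{\ j}.$$ An index $0$ denotes contraction with $y$: $s_0=s_py^p$, $s_{k0}=s_{kp}y^p$, $s^k_{\ 0}=s^k_{\ p}y^p$, $s_{0|0}=s_{p|q}y^py^q$, $s^k_{\ 0|k}=s^k_{\ p|k}y^p$. Assume that $\mathbf S=0$ on $TM\setminus\{0\}$. Then $\mathbf{Ric}=0$ on $TM\setminus\{0\}$ if and only if the following two equations hold in all local coordinate systems, for all $y\neq0$: $$s^k_{\ 0|k}=(n-1)\,s_js^j_{\ 0},$$ $$\overline{\mathbf{Ric}}=-(n-1)\big(s_{0|0}+s_0^2\big)+\alpha^2s^k_{\ j}s^j_{\ k}-2s_{k0}s^k_{\ 0}.$$ -/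

import Mathlib

open MeasureTheory Bundle
open scoped Manifold ContDiff

noncomputable section

namespace Finsler

/-- The coordinate space of an `n`-dimensional chart; it also holds the components `(y^i)` of a
tangent vector `y^i ∂/∂x^i`. Its volume is Lebesgue measure. -/
abbrev Coord (n : ℕ) : Type := EuclideanSpace ℝ (Fin n)

variable {n : ℕ}

/-- The partial derivative of `f` in the `i`-th coordinate at `x`. -/
def pd (i : Fin n) (f : Coord n → ℝ) (x : Coord n) : ℝ :=
  fderiv ℝ f x (EuclideanSpace.single i 1)

/-! ### Finsler geometry in a local coordinate system

`F x y` is the value of the metric on the vector `y^i ∂/∂x^i` at the point with coordinates `x`.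
-/

/-- The fundamental tensor `g_{ij}(x, y) = ½ [F²]_{y^i y^j}(x, y)`. -/
def fundTensor (F : Coord n → Coord n → ℝ) (x y : Coord n) : Matrix (Fin n) (Fin n) ℝ :=
  Matrix.of fun i j => (1 / 2 : ℝ) * pd i (fun y' => pd j (fun y'' => F x y'' ^ 2) y') y

/-- The geodesic coefficients
`G^i = ¼ g^{il} (2 ∂g_{jl}/∂x^k - ∂g_{jk}/∂x^l) y^j y^k`. -/
def geodesicCoeff (F : Coord n → Coord n → ℝ) (i : Fin n) (x y : Coord n) : ℝ :=
  (1 / 4 : ℝ) * ∑ l, (fundTensor F x y)⁻¹ i l *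
    ∑ j, ∑ k, (2 * pd k (fun x' => fundTensor F x' y j l) x
      - pd l (fun x' => fundTensor F x' y j k) x) * y j * y k

/-- The density `σ_F` of the Busemann-Hausdorff volume form `dV_F = σ_F dx^1 ⋯ dx^n`: the volume of
the Euclidean unit ball divided by the volume of `{y | F(x, y) < 1}`. -/
def volDensity (F : Coord n → Coord n → ℝ) (x : Coord n) : ℝ :=
  (volume (Metric.ball (0 : Coord n) 1)).toReal / (volume {y : Coord n | F x y < 1}).toReal

/-- The S-curvature `S = ∂G^i/∂y^i - y^i ∂(ln σ_F)/∂x^i`. -/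
def SCurv (F : Coord n → Coord n → ℝ) (x y : Coord n) : ℝ :=
  ∑ i, pd i (fun y' => geodesicCoeff F i x y') y
    - ∑ i, y i * pd i (fun x' => Real.log (volDensity F x')) x

/-- The Riemann curvature
`R^i_k = 2 ∂G^i/∂x^k - y^j ∂²G^i/∂x^j∂y^k + 2 G^j ∂²G^i/∂y^j∂y^k - ∂G^i/∂y^j ∂G^j/∂y^k`. -/
def riemannCurv (F : Coord n → Coord n → ℝ) (i k : Fin n) (x y : Coord n) : ℝ :=
  2 * pd k (fun x' => geodesicCoeff F i x' y) x
    - ∑ j, y j * pd j (fun x' => pd k (fun y' => geodesicCoeff F i x' y') y) x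
    + 2 * ∑ j, geodesicCoeff F j x y *
        pd j (fun y' => pd k (fun y'' => geodesicCoeff F i x y'') y') y
    - ∑ j, pd j (fun y' => geodesicCoeff F i x y') y * pd k (fun y' => geodesicCoeff F j x y') y

/-- The Ricci curvature `Ric(y) = R^i_i(x, y)`. -/
def ricciCurv (F : Coord n → Coord n → ℝ) (x y : Coord n) : ℝ :=
  ∑ i, riemannCurv F i i x y

/-! ### A Riemannian metric `a_{ij}` and a 1-form `b_i` in a local coordinate system -/

/-- The Christoffel symbols `Γ^k_{ij} = ½ a^{kl} (∂_i a_{jl} + ∂_j a_{il} - ∂_l a_{ij})` of the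
Levi-Civita connection. -/
def christoffel (a : Coord n → Matrix (Fin n) (Fin n) ℝ) (k i j : Fin n) (x : Coord n) : ℝ :=
  (1 / 2 : ℝ) * ∑ l, (a x)⁻¹ k l *
    (pd i (fun x' => a x' j l) x + pd j (fun x' => a x' i l) x - pd l (fun x' => a x' i j) x)

/-- The covariant derivative `w_{i|j} = ∂_j w_i - Γ^k_{ij} w_k` of a 1-form. -/
def covDerivForm (a : Coord n → Matrix (Fin n) (Fin n) ℝ) (w : Fin n → Coord n → ℝ)
    (i j : Fin n) (x : Coord n) : ℝ :=
  pd j (w i) x - ∑ k, christoffel a k i j x * w k x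

/-- The covariant derivative `T^i_{j|k} = ∂_k T^i_j + Γ^i_{mk} T^m_j - Γ^m_{jk} T^i_m` of a
tensor of type (1,1). -/
def covDerivEnd (a : Coord n → Matrix (Fin n) (Fin n) ℝ) (T : Fin n → Fin n → Coord n → ℝ)
    (i j k : Fin n) (x : Coord n) : ℝ :=
  pd k (T i j) x + ∑ m, christoffel a i m k x * T m j x - ∑ m, christoffel a m j k x * T i m x

/-- `s_{ij} = ½ (b_{i|j} - b_{j|i})`. -/
def sLow (a : Coord n → Matrix (Fin n) (Fin n) ℝ) (b : Fin n → Coord n → ℝ)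
    (i j : Fin n) (x : Coord n) : ℝ :=
  (1 / 2 : ℝ) * (covDerivForm a b i j x - covDerivForm a b j i x)

/-- `s^i_j = a^{ik} s_{kj}`. -/
def sMix (a : Coord n → Matrix (Fin n) (Fin n) ℝ) (b : Fin n → Coord n → ℝ)
    (i j : Fin n) (x : Coord n) : ℝ :=
  ∑ k, (a x)⁻¹ i k * sLow a b k j x

/-- `s_j = b_i s^i_j`. -/
def sForm (a : Coord n → Matrix (Fin n) (Fin n) ℝ) (b : Fin n → Coord n → ℝ)
    (j : Fin n) (x : Coord n) : ℝ :=
  ∑ i, b i x * sMix a b i j x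

/-! ### Randers metrics on a manifold -/

/-- A Randers metric `F = α + β` on an `n`-manifold `M`: a smooth Riemannian metric `metric`
(so `α(v) = √(metric(v, v))`) and a smooth 1-form `form` (this is `β`) with `‖β‖_α(p) =
sup_{v ≠ 0} β(v) / α(v) < 1` at every point `p`. -/
structure RandersMetric (n : ℕ) (M : Type*) [TopologicalSpace M] [ChartedSpace (Coord n) M]
    [IsManifold (𝓡 n) ∞ M] where
  metric : ContMDiffRiemannianMetric (𝓡 n) ∞ (Coord n) (fun p : M => TangentSpace (𝓡 n) p)
  form : ∀ p : M, TangentSpace (𝓡 n) p →L[ℝ] ℝ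
  form_smooth : ContMDiff (𝓡 n) ((𝓡 n).prod 𝓘(ℝ, Coord n →L[ℝ] ℝ)) ∞
    (fun p : M => TotalSpace.mk' (Coord n →L[ℝ] ℝ)
      (E := fun p : M => TangentSpace (𝓡 n) p →L[ℝ] Trivial M ℝ p) p (form p))
  norm_lt_one : ∀ p : M,
    (⨆ v : {v : TangentSpace (𝓡 n) p // v ≠ 0}, form p v.1 / √(metric.inner p v.1 v.1)) < 1

namespace RandersMetric

variable {M : Type*} [TopologicalSpace M] [ChartedSpace (Coord n) M] [IsManifold (𝓡 n) ∞ M]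

/-- The vector `y^i ∂/∂x^i` at the point with coordinates `x` in the chart `e`. -/
def vec (e : OpenPartialHomeomorph M (Coord n)) (x y : Coord n) :
    TangentSpace (𝓡 n) (e.symm x) :=
  mfderiv (𝓡 n) (𝓡 n) e.symm x y

/-- The components `a_{ij}(x)` of the Riemannian metric in the chart `e`. -/
def aCoeff (F : RandersMetric n M) (e : OpenPartialHomeomorph M (Coord n)) (x : Coord n) :
    Matrix (Fin n) (Fin n) ℝ :=
  Matrix.of fun i j => F.metric.inner (e.symm x)
    (vec e x (EuclideanSpace.single i 1)) (vec e x (EuclideanSpace.single j 1))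

/-- The components `b_i(x)` of the 1-form in the chart `e`. -/
def bCoeff (F : RandersMetric n M) (e : OpenPartialHomeomorph M (Coord n)) (i : Fin n)
    (x : Coord n) : ℝ :=
  F.form (e.symm x) (vec e x (EuclideanSpace.single i 1))

/-- `α` in the chart `e`. -/
def alpha (F : RandersMetric n M) (e : OpenPartialHomeomorph M (Coord n)) (x y : Coord n) : ℝ :=
  √(F.metric.inner (e.symm x) (vec e x y) (vec e x y))

/-- `F = α + β` in the chart `e`. -/
def inChart (F : RandersMetric n M) (e : OpenPartialHomeomorph M (Coord n)) (x y : Coord n) : ℝ :=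
  F.alpha e x y + F.form (e.symm x) (vec e x y)

/-- `s_{ij}` in the chart `e`. -/
def sL (F : RandersMetric n M) (e : OpenPartialHomeomorph M (Coord n)) (i j : Fin n)
    (x : Coord n) : ℝ :=
  sLow (F.aCoeff e) (F.bCoeff e) i j x

/-- `s^i_j` in the chart `e`. -/
def sM (F : RandersMetric n M) (e : OpenPartialHomeomorph M (Coord n)) (i j : Fin n)
    (x : Coord n) : ℝ :=
  sMix (F.aCoeff e) (F.bCoeff e) i j x

/-- `s_j` in the chart `e`. -/
def sF (F : RandersMetric n M) (e : OpenPartialHomeomorph M (Coord n)) (j : Fin n)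
    (x : Coord n) : ℝ :=
  sForm (F.aCoeff e) (F.bCoeff e) j x

/-- `s_0 = s_p y^p`. -/
def s0 (F : RandersMetric n M) (e : OpenPartialHomeomorph M (Coord n)) (x y : Coord n) : ℝ :=
  ∑ p, F.sF e p x * y p

/-- `s_{k0} = s_{kp} y^p`. -/
def sL0 (F : RandersMetric n M) (e : OpenPartialHomeomorph M (Coord n)) (k : Fin n)
    (x y : Coord n) : ℝ :=
  ∑ p, F.sL e k p x * y p

/-- `s^k_0 = s^k_p y^p`. -/
def sM0 (F : RandersMetric n M) (e : OpenPartialHomeomorph M (Coord n)) (k : Fin n)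
    (x y : Coord n) : ℝ :=
  ∑ p, F.sM e k p x * y p

/-- `s_{0|0} = s_{p|q} y^p y^q`. -/
def s00 (F : RandersMetric n M) (e : OpenPartialHomeomorph M (Coord n)) (x y : Coord n) : ℝ :=
  ∑ p, ∑ q, covDerivForm (F.aCoeff e) (F.sF e) p q x * y p * y q

/-- The divergence `s^k_{0|k} = s^k_{p|k} y^p`. -/
def divS0 (F : RandersMetric n M) (e : OpenPartialHomeomorph M (Coord n)) (x y : Coord n) : ℝ :=
  ∑ k, ∑ p, covDerivEnd (F.aCoeff e) (F.sM e) k p k x * y p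

/-- `S = 0` on `TM ∖ {0}`, expressed in every smooth chart. -/
def SCurvZero (F : RandersMetric n M) : Prop :=
  ∀ e ∈ IsManifold.maximalAtlas (𝓡 n) ∞ M, ∀ x ∈ e.target, ∀ y : Coord n, y ≠ 0 →
    SCurv (F.inChart e) x y = 0

/-- `Ric = 0` on `TM ∖ {0}`, expressed in every smooth chart. -/
def RicciZero (F : RandersMetric n M) : Prop :=
  ∀ e ∈ IsManifold.maximalAtlas (𝓡 n) ∞ M, ∀ x ∈ e.target, ∀ y : Coord n, y ≠ 0 →
    ricciCurv (F.inChart e) x y = 0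

end RandersMetric

end Finsler

end

/-!
In a chart, write `F = α + β` with `α = √(a_{ij} y^i y^j)` and `β = b_i y^i`, let
`Ḡ^i = ½ Γ^i_{jk} y^j y^k` be the geodesic coefficients of `α` and `r_{00} = b_{i|j} y^i y^j`. Since
`F_{y^i y^j} = α_{y^i y^j}`, the equation `g_{lm} G^m = ¼ (2 ∂_k g_{jl} - ∂_l g_{jk}) y^j y^k` can
be checked directly for
`G^i = Ḡ^i + α s^i_0 + P y^i`, `P = (r_{00} - 2 α s_0) / (2F)`
(`geodesicCoeff_randers`), and `g` is nondegenerate because `F > 0`.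

As `s^i_i = 0`, `y_i s^i_0 = 0` and `P` is 1-homogeneous, `S = (n + 1) P + λ(y)` with `λ` linear in
`y`. The volume density enters through `λ` only and need not be computed: `S = 0` at `y` and at `-y`
gives `P(y) + P(-y) = 0`, that is `r_{00} = -2 β s_0` (`sym00_eq_of_SCurv`), and then `P = -s_0`.

So the geodesic coefficients of `F` and `α` differ by `Q^i = α s^i_0 - s_0 y^i`. Inserting
`G = Ḡ + Q` in the curvature, and using that the Levi-Civita connection preserves `α`, yields
`Ric = Ric_α + (n-1)(s_{0|0} + s_0²) - α² s^k_j s^j_k + 2 s_{k0} s^k_0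
+ 2α (s^k_{0|k} - (n-1) s_j s^j_0)`
(`ricciCurv_randers`). The last term is odd in `y` and the others are even, so `Ric` vanishes
exactly when both parts do. The charts of a manifold supply the local hypotheses `IsRandersOn`; in
particular `‖β‖_α < 1` gives `F > 0`.
-/

open scoped Matrix

noncomputable section

namespace Finsler

variable {n : ℕ}

/-! ### Calculus of partial derivatives -/

theorem pd_congr {i : Fin n} {f g : Coord n → ℝ} {x : Coord n} (h : f =ᶠ[nhds x] g) :
    pd i f x = pd i g x := by
  rw [pd, pd, h.fderiv_eq]

theorem pd_congr_of_isOpen {U : Set (Coord n)} (hU : IsOpen U) {i : Fin n} {f g : Coord n → ℝ}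
    {x : Coord n} (hx : x ∈ U) (h : ∀ x' ∈ U, f x' = g x') : pd i f x = pd i g x :=
  pd_congr (Filter.eventuallyEq_of_mem (hU.mem_nhds hx) h)

@[simp] theorem pd_const (i : Fin n) (c : ℝ) (x : Coord n) : pd i (fun _ => c) x = 0 := by
  simp [pd]

theorem pd_add {i : Fin n} {f g : Coord n → ℝ} {x : Coord n} (hf : DifferentiableAt ℝ f x)
    (hg : DifferentiableAt ℝ g x) : pd i (fun x => f x + g x) x = pd i f x + pd i g x := by
  simp [pd, fderiv_fun_add hf hg]

theorem pd_sub {i : Fin n} {f g : Coord n → ℝ} {x : Coord n} (hf : DifferentiableAt ℝ f x)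
    (hg : DifferentiableAt ℝ g x) : pd i (fun x => f x - g x) x = pd i f x - pd i g x := by
  simp [pd, fderiv_fun_sub hf hg]

theorem pd_neg (i : Fin n) (f : Coord n → ℝ) (x : Coord n) :
    pd i (fun x => -f x) x = -pd i f x := by
  simp [pd, fderiv_fun_neg]

theorem pd_mul {i : Fin n} {f g : Coord n → ℝ} {x : Coord n} (hf : DifferentiableAt ℝ f x)
    (hg : DifferentiableAt ℝ g x) :
    pd i (fun x => f x * g x) x = pd i f x * g x + f x * pd i g x := by
  simp [pd, fderiv_fun_mul hf hg]; ring

theorem pd_mul_const {i : Fin n} {f : Coord n → ℝ} {x : Coord n} (hf : DifferentiableAt ℝ f x)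
    (c : ℝ) : pd i (fun x => f x * c) x = pd i f x * c := by
  simp [pd_mul hf (differentiableAt_const c)]

theorem pd_const_mul {i : Fin n} {f : Coord n → ℝ} {x : Coord n} (hf : DifferentiableAt ℝ f x)
    (c : ℝ) : pd i (fun x => c * f x) x = c * pd i f x := by
  simp [pd_mul (differentiableAt_const c) hf]

theorem pd_sum {ι : Type*} {s : Finset ι} {i : Fin n} {f : ι → Coord n → ℝ} {x : Coord n}
    (hf : ∀ j ∈ s, DifferentiableAt ℝ (f j) x) :
    pd i (fun x => ∑ j ∈ s, f j x) x = ∑ j ∈ s, pd i (f j) x := by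
  simp [pd, fderiv_fun_sum hf]

theorem pd_sqrt {i : Fin n} {f : Coord n → ℝ} {x : Coord n} (hf : DifferentiableAt ℝ f x)
    (h : f x ≠ 0) : pd i (fun x => √(f x)) x = pd i f x / (2 * √(f x)) := by
  simp [pd, fderiv_sqrt hf h]; ring

theorem differentiableAt_fun_div {f g : Coord n → ℝ} {x : Coord n} (hf : DifferentiableAt ℝ f x)
    (hg : DifferentiableAt ℝ g x) (h : g x ≠ 0) : DifferentiableAt ℝ (fun x => f x / g x) x := by
  simpa only [div_eq_mul_inv] using hf.fun_mul (hg.fun_inv h)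

theorem pd_div {i : Fin n} {f g : Coord n → ℝ} {x : Coord n} (hf : DifferentiableAt ℝ f x)
    (hg : DifferentiableAt ℝ g x) (h : g x ≠ 0) :
    pd i (fun x => f x / g x) x = pd i f x / g x - f x * pd i g x / g x ^ 2 := by
  have h1 : pd i f x = pd i (fun x => f x / g x * g x) x :=
    pd_congr ((hg.continuousAt.eventually_ne h).mono fun z hz => (div_mul_cancel₀ _ hz).symm)
  rw [pd_mul (differentiableAt_fun_div hf hg h) hg] at h1
  rw [h1]
  field_simp
  ring

theorem differentiableAt_coord (j : Fin n) (y : Coord n) :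
    DifferentiableAt ℝ (fun y : Coord n => y j) y := by fun_prop

theorem sum_smul_single (y : Coord n) : ∑ i, y i • EuclideanSpace.single i (1 : ℝ) = y := by
  conv_rhs => rw [← (EuclideanSpace.basisFun (Fin n) ℝ).sum_repr y]
  simp

theorem pd_coord (i j : Fin n) (y : Coord n) :
    pd i (fun y : Coord n => y j) y = if i = j then 1 else 0 := by
  have : (fun y : Coord n => y j) = EuclideanSpace.proj (𝕜 := ℝ) j := by ext; simp
  rw [pd, this, ContinuousLinearMap.fderiv]
  simp [eq_comm]

theorem pd_linear (i : Fin n) (c : Fin n → ℝ) (y : Coord n) :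
    pd i (fun y : Coord n => ∑ j, c j * y j) y = c i := by
  rw [pd_sum (fun j _ => by fun_prop)]
  simp [pd_const_mul (differentiableAt_coord _ _), pd_coord]

theorem pd_quadratic (i : Fin n) (c : Fin n → Fin n → ℝ) (hc : ∀ j k, c j k = c k j)
    (y : Coord n) :
    pd i (fun y : Coord n => ∑ j, ∑ k, c j k * y j * y k) y = 2 * ∑ j, c i j * y j := by
  rw [pd_sum (fun j _ => by fun_prop)]
  have : ∀ j, pd i (fun y : Coord n => ∑ k, c j k * y j * y k) y
      = (if i = j then ∑ k, c j k * y k else 0) + c j i * y j := by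
    intro j
    have h1 : (fun y : Coord n => ∑ k, c j k * y j * y k)
        = fun y : Coord n => y j * ∑ k, c j k * y k := by
      funext y; rw [Finset.mul_sum]; exact Finset.sum_congr rfl fun k _ => by ring
    rw [h1, pd_mul (by fun_prop) (by fun_prop), pd_coord, pd_linear]
    split_ifs <;> ring
  simp only [this, Finset.sum_add_distrib, Finset.sum_ite_eq, Finset.mem_univ, if_true]
  rw [two_mul]; congr 1
  exact Finset.sum_congr rfl fun j _ => by rw [hc]

/-! ### Riemannian metrics and 1-forms in coordinates -/

/-- The quadratic form `a_{ij}(x) y^i y^j = α²`. -/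
def quad (a : Coord n → Matrix (Fin n) (Fin n) ℝ) (x y : Coord n) : ℝ :=
  ∑ i, ∑ j, a x i j * y i * y j

/-- The lowered components `y_i = a_{ij}(x) y^j`. -/
def low (a : Coord n → Matrix (Fin n) (Fin n) ℝ) (i : Fin n) (x y : Coord n) : ℝ :=
  ∑ j, a x i j * y j

/-- The Riemannian norm `α = √(a_{ij} y^i y^j)`. -/
def riem (a : Coord n → Matrix (Fin n) (Fin n) ℝ) (x y : Coord n) : ℝ := √(quad a x y)

/-- The gradient `α_{y^i} = y_i / α`. -/
def riemGrad (a : Coord n → Matrix (Fin n) (Fin n) ℝ) (i : Fin n) (x y : Coord n) : ℝ :=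
  low a i x y / riem a x y

/-- The Hessian `α_{y^i y^j} = a_{ij} / α - y_i y_j / α³`. -/
def riemHess (a : Coord n → Matrix (Fin n) (Fin n) ℝ) (i j : Fin n) (x y : Coord n) : ℝ :=
  a x i j / riem a x y - low a i x y * low a j x y / riem a x y ^ 3

/-- The value `w_i(x) y^i` of a 1-form. -/
def contr (w : Fin n → Coord n → ℝ) (x y : Coord n) : ℝ := ∑ i, w i x * y i

/-- The Randers metric `α + β` with `α = √(a_{ij} y^i y^j)` and `β = b_i y^i`. -/
def randers (a : Coord n → Matrix (Fin n) (Fin n) ℝ) (b : Fin n → Coord n → ℝ)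
    (x y : Coord n) : ℝ :=
  riem a x y + contr b x y

/-- The geodesic coefficients `½ Γ^i_{jk} y^j y^k` of the Riemannian metric `a`. -/
def baseSpray (a : Coord n → Matrix (Fin n) (Fin n) ℝ) (i : Fin n) (x y : Coord n) : ℝ :=
  (1 / 2 : ℝ) * ∑ j, ∑ k, christoffel a i j k x * y j * y k

/-- The function `a_{ij} y^i y^j` is a `C²` Riemannian metric on the open set `U`, and `b` is a `C²`
1-form there with `α + β > 0` off the zero section. Symmetry is required at all `x`, also outside
`U`; this costs nothing for coefficients read in a chart. -/
structure IsRandersOn (a : Coord n → Matrix (Fin n) (Fin n) ℝ) (b : Fin n → Coord n → ℝ)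
    (U : Set (Coord n)) : Prop where
  isOpen : IsOpen U
  symm : ∀ x i j, a x i j = a x j i
  quad_pos : ∀ x ∈ U, ∀ y : Coord n, y ≠ 0 → 0 < quad a x y
  pos : ∀ x ∈ U, ∀ y : Coord n, y ≠ 0 → 0 < randers a b x y
  contDiffOn_metric : ∀ i j, ContDiffOn ℝ 2 (fun x => a x i j) U
  contDiffOn_form : ∀ i, ContDiffOn ℝ 2 (b i) U

variable {a : Coord n → Matrix (Fin n) (Fin n) ℝ} {b : Fin n → Coord n → ℝ}
  {U : Set (Coord n)} {x y : Coord n}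

theorem quad_eq_sum_low (a : Coord n → Matrix (Fin n) (Fin n) ℝ) (x y : Coord n) :
    quad a x y = ∑ i, low a i x y * y i := by
  simp only [quad, low, Finset.sum_mul]
  exact Finset.sum_congr rfl fun i _ => Finset.sum_congr rfl fun j _ => by ring

namespace IsRandersOn

/-- Forgetting `β` leaves the Riemannian metric `α`. -/
theorem riemannian (h : IsRandersOn a b U) : IsRandersOn a (fun _ _ => 0) U where
  isOpen := h.isOpen
  symm := h.symm
  quad_pos := h.quad_pos
  pos x hx y hy := by
    simpa [randers, contr, riem] using h.quad_pos x hx y hy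
  contDiffOn_metric := h.contDiffOn_metric
  contDiffOn_form _ := contDiffOn_const

theorem riem_pos (h : IsRandersOn a b U) (hx : x ∈ U) (hy : y ≠ 0) : 0 < riem a x y :=
  Real.sqrt_pos.2 (h.quad_pos x hx y hy)

theorem riem_sq (h : IsRandersOn a b U) (hx : x ∈ U) (hy : y ≠ 0) :
    riem a x y ^ 2 = quad a x y :=
  Real.sq_sqrt (h.quad_pos x hx y hy).le

theorem eq_zero_of_low_eq_zero (h : IsRandersOn a b U) (hx : x ∈ U)
    (hl : ∀ i, low a i x y = 0) : y = 0 := by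
  by_contra hy
  have := h.quad_pos x hx y hy
  simp [quad_eq_sum_low, hl] at this

theorem isUnit_det (h : IsRandersOn a b U) (hx : x ∈ U) : IsUnit (a x).det := by
  rw [isUnit_iff_ne_zero]
  intro h0
  obtain ⟨v, hv, hav⟩ := Matrix.exists_mulVec_eq_zero_iff.2 h0
  apply hv
  have : WithLp.toLp 2 v = (0 : Coord n) := h.eq_zero_of_low_eq_zero hx fun i => by
    simpa [low, Matrix.mulVec, dotProduct] using congrFun hav i
  funext i
  simpa using congrArg (fun w : Coord n => w i) this

/-! ### Differentiability in the base point -/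

theorem contDiffAt_metric (h : IsRandersOn a b U) (hx : x ∈ U) (i j : Fin n) :
    ContDiffAt ℝ 2 (fun x => a x i j) x :=
  (h.contDiffOn_metric i j).contDiffAt (h.isOpen.mem_nhds hx)

theorem contDiffAt_form (h : IsRandersOn a b U) (hx : x ∈ U) (i : Fin n) :
    ContDiffAt ℝ 2 (b i) x :=
  (h.contDiffOn_form i).contDiffAt (h.isOpen.mem_nhds hx)

theorem diff_metric (h : IsRandersOn a b U) (hx : x ∈ U) (i j : Fin n) :
    DifferentiableAt ℝ (fun x => a x i j) x :=
  (h.contDiffAt_metric hx i j).differentiableAt (by norm_num)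

theorem diff_form (h : IsRandersOn a b U) (hx : x ∈ U) (i : Fin n) :
    DifferentiableAt ℝ (b i) x :=
  (h.contDiffAt_form hx i).differentiableAt (by norm_num)

end IsRandersOn

theorem differentiableAt_pd {f : Coord n → ℝ} (hf : ContDiffAt ℝ 2 f x) (i : Fin n) :
    DifferentiableAt ℝ (pd i f) x := by
  have h1 : ContDiffAt ℝ 1 (fderiv ℝ f) x := hf.fderiv_right (by norm_num)
  exact (h1.differentiableAt (by norm_num)).clm_apply (differentiableAt_const _)

theorem differentiableAt_det {m : ℕ} {A : Coord n → Matrix (Fin m) (Fin m) ℝ}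
    (hA : ∀ i j, DifferentiableAt ℝ (fun x => A x i j) x) :
    DifferentiableAt ℝ (fun x => (A x).det) x := by
  simp only [Matrix.det_apply']
  exact DifferentiableAt.fun_sum fun σ _ => (differentiableAt_const _).mul
    ((HasFDerivAt.finsetProd fun i _ => (hA (σ i) i).hasFDerivAt).differentiableAt)

theorem differentiableAt_inv_matrix {m : ℕ} {A : Coord n → Matrix (Fin m) (Fin m) ℝ}
    (hA : ∀ i j, DifferentiableAt ℝ (fun x => A x i j) x) (hdet : (A x).det ≠ 0) (i j : Fin m) :
    DifferentiableAt ℝ (fun x => (A x)⁻¹ i j) x := by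
  simp only [Matrix.inv_def, Ring.inverse_eq_inv', Matrix.smul_apply, smul_eq_mul,
    Matrix.adjugate_apply]
  refine ((differentiableAt_det hA).fun_inv hdet).mul (differentiableAt_det fun k l => ?_)
  simp only [Matrix.updateRow_apply]
  split_ifs
  · exact differentiableAt_const _
  · exact hA k l

theorem diff_base_contr {w : Fin n → Coord n → ℝ} (hw : ∀ i, DifferentiableAt ℝ (w i) x)
    (y : Coord n) : DifferentiableAt ℝ (fun x => contr w x y) x :=
  DifferentiableAt.fun_sum fun i _ => (hw i).mul_const _

theorem pd_base_contr {w : Fin n → Coord n → ℝ} (hw : ∀ i, DifferentiableAt ℝ (w i) x)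
    (k : Fin n) (y : Coord n) :
    pd k (fun x => contr w x y) x = ∑ i, pd k (w i) x * y i := by
  simp only [contr]
  rw [pd_sum fun j _ => (hw j).mul_const _]
  exact Finset.sum_congr rfl fun j _ => pd_mul_const (hw j) _

namespace IsRandersOn

theorem diff_inv (h : IsRandersOn a b U) (hx : x ∈ U) (i j : Fin n) :
    DifferentiableAt ℝ (fun x => (a x)⁻¹ i j) x :=
  differentiableAt_inv_matrix (h.diff_metric hx) (h.isUnit_det hx).ne_zero i j

theorem diff_christoffel (h : IsRandersOn a b U) (hx : x ∈ U) (k i j : Fin n) :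
    DifferentiableAt ℝ (christoffel a k i j) x := by
  have h1 := fun i j k => differentiableAt_pd (h.contDiffAt_metric hx i j) k
  exact (DifferentiableAt.fun_sum fun l _ =>
    (h.diff_inv hx k l).mul (((h1 _ _ _).add (h1 _ _ _)).sub (h1 _ _ _))).const_mul _

theorem diff_covDerivForm (h : IsRandersOn a b U) (hx : x ∈ U) (i j : Fin n) :
    DifferentiableAt ℝ (covDerivForm a b i j) x :=
  (differentiableAt_pd (h.contDiffAt_form hx i) j).sub
    (DifferentiableAt.fun_sum fun k _ => (h.diff_christoffel hx k i j).mul (h.diff_form hx k))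

theorem diff_sLow (h : IsRandersOn a b U) (hx : x ∈ U) (i j : Fin n) :
    DifferentiableAt ℝ (sLow a b i j) x :=
  ((h.diff_covDerivForm hx i j).sub (h.diff_covDerivForm hx j i)).const_mul _

theorem diff_sMix (h : IsRandersOn a b U) (hx : x ∈ U) (i j : Fin n) :
    DifferentiableAt ℝ (sMix a b i j) x :=
  DifferentiableAt.fun_sum fun k _ => (h.diff_inv hx i k).mul (h.diff_sLow hx k j)

theorem diff_sForm (h : IsRandersOn a b U) (hx : x ∈ U) (j : Fin n) :
    DifferentiableAt ℝ (sForm a b j) x :=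
  DifferentiableAt.fun_sum fun i _ => (h.diff_form hx i).mul (h.diff_sMix hx i j)

theorem diff_quad (h : IsRandersOn a b U) (hx : x ∈ U) (y : Coord n) :
    DifferentiableAt ℝ (fun x => quad a x y) x :=
  DifferentiableAt.fun_sum fun i _ => DifferentiableAt.fun_sum fun j _ =>
    ((h.diff_metric hx i j).mul_const _).mul_const _

theorem diff_low (h : IsRandersOn a b U) (hx : x ∈ U) (i : Fin n) (y : Coord n) :
    DifferentiableAt ℝ (fun x => low a i x y) x :=
  DifferentiableAt.fun_sum fun j _ => (h.diff_metric hx i j).mul_const _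

theorem diff_riem (h : IsRandersOn a b U) (hx : x ∈ U) (hy : y ≠ 0) :
    DifferentiableAt ℝ (fun x => riem a x y) x :=
  (h.diff_quad hx y).sqrt (h.quad_pos x hx y hy).ne'

theorem diff_riemGrad (h : IsRandersOn a b U) (hx : x ∈ U) (hy : y ≠ 0) (i : Fin n) :
    DifferentiableAt ℝ (fun x => riemGrad a i x y) x :=
  differentiableAt_fun_div (h.diff_low hx i y) (h.diff_riem hx hy) (h.riem_pos hx hy).ne'

theorem diff_riemHess (h : IsRandersOn a b U) (hx : x ∈ U) (hy : y ≠ 0) (i j : Fin n) :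
    DifferentiableAt ℝ (fun x => riemHess a i j x y) x :=
  (differentiableAt_fun_div (h.diff_metric hx i j) (h.diff_riem hx hy) (h.riem_pos hx hy).ne').sub
    (differentiableAt_fun_div ((h.diff_low hx i y).mul (h.diff_low hx j y))
      ((h.diff_riem hx hy).pow 3) (pow_pos (h.riem_pos hx hy) 3).ne')

theorem diff_randers (h : IsRandersOn a b U) (hx : x ∈ U) (hy : y ≠ 0) :
    DifferentiableAt ℝ (fun x => randers a b x y) x :=
  (h.diff_riem hx hy).add (diff_base_contr (h.diff_form hx) y)

theorem pd_base_low (h : IsRandersOn a b U) (hx : x ∈ U) (k i : Fin n) (y : Coord n) :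
    pd k (fun x => low a i x y) x = ∑ j, pd k (fun x => a x i j) x * y j := by
  simp only [low]
  rw [pd_sum fun j _ => (h.diff_metric hx i j).mul_const _]
  exact Finset.sum_congr rfl fun j _ => pd_mul_const (h.diff_metric hx i j) _

theorem pd_base_quad (h : IsRandersOn a b U) (hx : x ∈ U) (k : Fin n) (y : Coord n) :
    pd k (fun x => quad a x y) x = ∑ i, ∑ j, pd k (fun x => a x i j) x * y i * y j := by
  simp only [quad]
  rw [pd_sum fun i _ => DifferentiableAt.fun_sum fun j _ =>
    ((h.diff_metric hx i j).mul_const _).mul_const _]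
  refine Finset.sum_congr rfl fun i _ => ?_
  rw [pd_sum fun j _ => ((h.diff_metric hx i j).mul_const _).mul_const _]
  refine Finset.sum_congr rfl fun j _ => ?_
  rw [pd_mul_const ((h.diff_metric hx i j).mul_const _), pd_mul_const (h.diff_metric hx i j)]

theorem pd_base_riem (h : IsRandersOn a b U) (hx : x ∈ U) (hy : y ≠ 0) (k : Fin n) :
    pd k (fun x => riem a x y) x = pd k (fun x => quad a x y) x / (2 * riem a x y) :=
  pd_sqrt (h.diff_quad hx y) (h.quad_pos x hx y hy).ne'

theorem pd_base_riemGrad (h : IsRandersOn a b U) (hx : x ∈ U) (hy : y ≠ 0) (k i : Fin n) :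
    pd k (fun x => riemGrad a i x y) x = pd k (fun x => low a i x y) x / riem a x y
      - low a i x y * pd k (fun x => riem a x y) x / riem a x y ^ 2 :=
  pd_div (h.diff_low hx i y) (h.diff_riem hx hy) (h.riem_pos hx hy).ne'

end IsRandersOn

/-! ### Derivatives in the direction variable -/

theorem diff_vert_quad (a : Coord n → Matrix (Fin n) (Fin n) ℝ) (x y : Coord n) :
    DifferentiableAt ℝ (fun y => quad a x y) y := by
  unfold quad; fun_prop

theorem diff_vert_low (a : Coord n → Matrix (Fin n) (Fin n) ℝ) (i : Fin n) (x y : Coord n) :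
    DifferentiableAt ℝ (fun y => low a i x y) y := by
  unfold low; fun_prop

theorem diff_vert_contr (b : Fin n → Coord n → ℝ) (x y : Coord n) :
    DifferentiableAt ℝ (fun y => contr b x y) y := by
  unfold contr; fun_prop

theorem pd_vert_low (a : Coord n → Matrix (Fin n) (Fin n) ℝ) (k i : Fin n) (x y : Coord n) :
    pd k (fun y => low a i x y) y = a x i k := pd_linear k _ y

theorem pd_vert_contr (b : Fin n → Coord n → ℝ) (k : Fin n) (x y : Coord n) :
    pd k (fun y => contr b x y) y = b k x := pd_linear k _ y

namespace IsRandersOn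

theorem diff_vert_riem (h : IsRandersOn a b U) (hx : x ∈ U) (hy : y ≠ 0) :
    DifferentiableAt ℝ (fun y => riem a x y) y :=
  (diff_vert_quad a x y).sqrt (h.quad_pos x hx y hy).ne'

theorem diff_vert_riemGrad (h : IsRandersOn a b U) (hx : x ∈ U) (hy : y ≠ 0) (i : Fin n) :
    DifferentiableAt ℝ (fun y => riemGrad a i x y) y :=
  differentiableAt_fun_div (diff_vert_low a i x y) (h.diff_vert_riem hx hy) (h.riem_pos hx hy).ne'

theorem pd_vert_riem (h : IsRandersOn a b U) (hx : x ∈ U) (hy : y ≠ 0) (k : Fin n) :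
    pd k (fun y => riem a x y) y = riemGrad a k x y := by
  unfold riem
  rw [pd_sqrt (diff_vert_quad a x y) (h.quad_pos x hx y hy).ne']
  unfold quad
  rw [pd_quadratic k _ (h.symm x), riemGrad, mul_div_mul_left _ _ two_ne_zero]
  rfl

theorem pd_vert_riemGrad (h : IsRandersOn a b U) (hx : x ∈ U) (hy : y ≠ 0) (k i : Fin n) :
    pd k (fun y => riemGrad a i x y) y = riemHess a k i x y := by
  have := h.riem_pos hx hy
  unfold riemGrad
  rw [pd_div (diff_vert_low a i x y) (h.diff_vert_riem hx hy) this.ne', pd_vert_low,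
    h.pd_vert_riem hx hy, riemHess, riemGrad, h.symm x k i]
  field_simp

/-- The fundamental tensor of a Randers metric is `F_{y^i} F_{y^j} + F α_{y^i y^j}`. -/
theorem fundTensor_randers (h : IsRandersOn a b U) (hx : x ∈ U) (hy : y ≠ 0) (i j : Fin n) :
    fundTensor (randers a b) x y i j =
      (riemGrad a i x y + b i x) * (riemGrad a j x y + b j x)
        + randers a b x y * riemHess a i j x y := by
  have hd : ∀ y : Coord n, y ≠ 0 → DifferentiableAt ℝ (fun y => randers a b x y) y := fun y hy =>
    (h.diff_vert_riem hx hy).add (diff_vert_contr b x y)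
  have hF : ∀ k, ∀ y : Coord n, y ≠ 0 →
      pd k (fun y => randers a b x y) y = riemGrad a k x y + b k x := fun k y hy => by
    unfold randers
    rw [pd_add (h.diff_vert_riem hx hy) (diff_vert_contr b x y), h.pd_vert_riem hx hy,
      pd_vert_contr]
  have h1 : ∀ y' ∈ {y : Coord n | y ≠ 0}, pd j (fun y'' => randers a b x y'' ^ 2) y'
      = 2 * (randers a b x y' * (riemGrad a j x y' + b j x)) := fun y' hy' => by
    simp only [sq]
    rw [pd_mul (hd _ hy') (hd _ hy'), hF _ _ hy']
    ring
  have hg := h.diff_vert_riemGrad hx hy j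
  rw [fundTensor, Matrix.of_apply, pd_congr_of_isOpen isOpen_ne hy h1,
    pd_const_mul ((hd _ hy).fun_mul (hg.add_const _)), pd_mul (hd _ hy) (hg.add_const _), hF _ _ hy,
    pd_add hg (differentiableAt_const _), h.pd_vert_riemGrad hx hy, pd_const]
  ring

end IsRandersOn

/-! ### Geodesic coefficients of a Randers metric -/

/-- `s^i_0 = s^i_p y^p`. -/
def mix0 (a : Coord n → Matrix (Fin n) (Fin n) ℝ) (b : Fin n → Coord n → ℝ) (i : Fin n)
    (x y : Coord n) : ℝ :=
  ∑ p, sMix a b i p x * y p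

/-- `s_{i0} = s_{ip} y^p`. -/
def low0 (a : Coord n → Matrix (Fin n) (Fin n) ℝ) (b : Fin n → Coord n → ℝ) (i : Fin n)
    (x y : Coord n) : ℝ :=
  ∑ p, sLow a b i p x * y p

/-- `w_{0|0} = w_{i|j} y^i y^j` for a 1-form `w`; for `β` this is `r_{00}`. -/
def sym00 (a : Coord n → Matrix (Fin n) (Fin n) ℝ) (w : Fin n → Coord n → ℝ)
    (x y : Coord n) : ℝ :=
  ∑ i, ∑ j, covDerivForm a w i j x * y i * y j

/-- The factor `P = (r_{00} - 2 α s_0) / (2F)` in `G^i = Ḡ^i + α s^i_0 + P y^i`. -/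
def projFactor (a : Coord n → Matrix (Fin n) (Fin n) ℝ) (b : Fin n → Coord n → ℝ)
    (x y : Coord n) : ℝ :=
  (sym00 a b x y - 2 * riem a x y * contr (sForm a b) x y) / (2 * randers a b x y)

theorem sLow_antisymm (a : Coord n → Matrix (Fin n) (Fin n) ℝ) (b : Fin n → Coord n → ℝ)
    (i j : Fin n) (x : Coord n) : sLow a b i j x = -sLow a b j i x := by
  unfold sLow; ring

theorem sum_low0_mul_self (a : Coord n → Matrix (Fin n) (Fin n) ℝ) (b : Fin n → Coord n → ℝ)
    (x y : Coord n) : ∑ i, low0 a b i x y * y i = 0 := by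
  have h1 : ∑ i, low0 a b i x y * y i = -∑ i, low0 a b i x y * y i := by
    conv_lhs => simp only [low0, Finset.sum_mul]
    rw [Finset.sum_comm, ← Finset.sum_neg_distrib]
    refine Finset.sum_congr rfl fun i _ => ?_
    rw [low0, Finset.sum_mul, ← Finset.sum_neg_distrib]
    refine Finset.sum_congr rfl fun j _ => ?_
    rw [sLow_antisymm a b j i]; ring
  linarith

theorem sum_form_mul_mix0 (a : Coord n → Matrix (Fin n) (Fin n) ℝ) (b : Fin n → Coord n → ℝ)
    (x y : Coord n) : ∑ i, b i x * mix0 a b i x y = contr (sForm a b) x y := by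
  simp only [mix0, contr, sForm, Finset.mul_sum, Finset.sum_mul]
  rw [Finset.sum_comm]
  exact Finset.sum_congr rfl fun i _ => Finset.sum_congr rfl fun j _ => by ring

/-- `y^k ∂_k w_0 = w_{0|0} + 2 w_m Ḡ^m`. -/
theorem sum_pd_base_contr (a : Coord n → Matrix (Fin n) (Fin n) ℝ)
    {w : Fin n → Coord n → ℝ} (hw : ∀ i, DifferentiableAt ℝ (w i) x) (y : Coord n) :
    ∑ k, y k * pd k (fun x => contr w x y) x
      = sym00 a w x y + 2 * ∑ m, w m x * baseSpray a m x y := by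
  have h1 : sym00 a w x y = ∑ i, ∑ j, pd j (w i) x * y i * y j
      - ∑ i, ∑ j, ∑ k, christoffel a k i j x * w k x * y i * y j := by
    simp only [sym00, covDerivForm, sub_mul, Finset.sum_sub_distrib, Finset.sum_mul]
  have h2 : 2 * ∑ m, w m x * baseSpray a m x y
      = ∑ i, ∑ j, ∑ k, christoffel a k i j x * w k x * y i * y j := by
    simp only [baseSpray, Finset.mul_sum]
    rw [Finset.sum_comm]
    refine Finset.sum_congr rfl fun i _ => ?_
    rw [Finset.sum_comm]
    exact Finset.sum_congr rfl fun j _ => Finset.sum_congr rfl fun k _ => by ring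
  rw [h1, h2, sub_add_cancel]
  simp only [pd_base_contr hw, Finset.mul_sum]
  rw [Finset.sum_comm]
  exact Finset.sum_congr rfl fun j _ => Finset.sum_congr rfl fun k _ => by ring

/-- `α_{y^i y^j} v^j = (v_i - y_i (y_j v^j) / α²) / α`. -/
theorem sum_riemHess_mul (l : Fin n) (v : Fin n → ℝ) :
    ∑ m, riemHess a l m x y * v m = (∑ m, a x l m * v m) / riem a x y
      - low a l x y * (∑ m, low a m x y * v m) / riem a x y ^ 3 := by
  simp only [riemHess, sub_mul, Finset.sum_sub_distrib, Finset.mul_sum, Finset.sum_div]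
  congr 1 <;> exact Finset.sum_congr rfl fun i _ => by ring

theorem sum_riemGrad_mul (v : Fin n → ℝ) :
    ∑ m, riemGrad a m x y * v m = (∑ m, low a m x y * v m) / riem a x y := by
  simp only [riemGrad, Finset.sum_div]
  exact Finset.sum_congr rfl fun i _ => by ring

namespace IsRandersOn

theorem sum_mul_sum_inv (h : IsRandersOn a b U) (hx : x ∈ U) (l : Fin n) (v : Fin n → ℝ) :
    ∑ m, a x l m * ∑ p, (a x)⁻¹ m p * v p = v l := by
  have : (a x) *ᵥ ((a x)⁻¹ *ᵥ v) = v := by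
    rw [Matrix.mulVec_mulVec, Matrix.mul_nonsing_inv _ (h.isUnit_det hx), Matrix.one_mulVec]
  exact congrFun this l

/-- Lowering an index is symmetric: `y_i v^i = y^i v_i`. -/
theorem sum_low_mul (h : IsRandersOn a b U) (x y : Coord n) (v : Fin n → ℝ) :
    ∑ i, low a i x y * v i = ∑ i, y i * ∑ m, a x i m * v m := by
  simp only [low, Finset.sum_mul, Finset.mul_sum]
  rw [Finset.sum_comm]
  exact Finset.sum_congr rfl fun i _ => Finset.sum_congr rfl fun j _ => by
    rw [h.symm x j i]; ring

theorem pd_metric_symm (h : IsRandersOn a b U) (x : Coord n) (k i j : Fin n) :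
    pd k (fun x => a x i j) x = pd k (fun x => a x j i) x := by
  simp only [h.symm _ i j]

theorem christoffel_symm (h : IsRandersOn a b U) (k i j : Fin n) (x : Coord n) :
    christoffel a k i j x = christoffel a k j i x := by
  unfold christoffel
  congr 1
  refine Finset.sum_congr rfl fun l _ => ?_
  rw [h.pd_metric_symm x l i j]; ring

theorem lower_christoffel (h : IsRandersOn a b U) (hx : x ∈ U) (l j k : Fin n) :
    ∑ m, a x l m * christoffel a m j k x = (1 / 2 : ℝ) *
      (pd j (fun x => a x k l) x + pd k (fun x => a x j l) x - pd l (fun x => a x j k) x) := by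
  rw [← h.sum_mul_sum_inv hx l fun l =>
    (pd j (fun x => a x k l) x + pd k (fun x => a x j l) x - pd l (fun x => a x j k) x),
    Finset.mul_sum]
  exact Finset.sum_congr rfl fun m _ => by rw [christoffel]; ring

theorem lower_baseSpray (h : IsRandersOn a b U) (hx : x ∈ U) (l : Fin n) (y : Coord n) :
    2 * ∑ m, a x l m * baseSpray a m x y =
      ∑ k, y k * pd k (fun x => low a l x y) x - (1 / 2 : ℝ) * pd l (fun x => quad a x y) x := by
  have h1 : 2 * ∑ m, a x l m * baseSpray a m x y
      = ∑ j, ∑ k, (∑ m, a x l m * christoffel a m j k x) * (y j * y k) := by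
    simp only [baseSpray, Finset.mul_sum, Finset.sum_mul]
    rw [Finset.sum_comm]
    refine Finset.sum_congr rfl fun i _ => ?_
    rw [Finset.sum_comm]
    exact Finset.sum_congr rfl fun j _ => Finset.sum_congr rfl fun k _ => by ring
  have h2 : ∑ j, ∑ k, pd j (fun x => a x k l) x * (y j * y k)
      = ∑ k, y k * pd k (fun x => low a l x y) x := by
    refine Finset.sum_congr rfl fun j _ => ?_
    rw [h.pd_base_low hx, Finset.mul_sum]
    refine Finset.sum_congr rfl fun k _ => ?_
    rw [h.pd_metric_symm x j k l]; ring
  have h3 : ∑ j, ∑ k, pd k (fun x => a x j l) x * (y j * y k)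
      = ∑ k, y k * pd k (fun x => low a l x y) x := by
    rw [← h2, Finset.sum_comm]
    exact Finset.sum_congr rfl fun j _ => Finset.sum_congr rfl fun k _ => by ring
  have h4 : ∑ j, ∑ k, pd l (fun x => a x j k) x * (y j * y k) = pd l (fun x => quad a x y) x := by
    rw [h.pd_base_quad hx]
    exact Finset.sum_congr rfl fun j _ => Finset.sum_congr rfl fun k _ => by ring
  rw [h1]
  simp only [h.lower_christoffel hx, mul_assoc, ← Finset.mul_sum, sub_mul, add_mul,
    Finset.sum_sub_distrib, Finset.sum_add_distrib]
  rw [h2, h3, h4]; ring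

theorem sum_baseSpray_low (h : IsRandersOn a b U) (hx : x ∈ U) (y : Coord n) :
    ∑ k, y k * pd k (fun x => quad a x y) x = 4 * ∑ m, low a m x y * baseSpray a m x y := by
  have h1 : ∑ l, y l * ∑ k, y k * pd k (fun x => low a l x y) x
      = ∑ k, y k * pd k (fun x => quad a x y) x := by
    simp only [h.pd_base_low hx, h.pd_base_quad hx, Finset.mul_sum]
    rw [Finset.sum_comm]
    exact Finset.sum_congr rfl fun j _ => Finset.sum_congr rfl fun k _ =>
      Finset.sum_congr rfl fun l _ => by ring
  have h2 : ∑ l, y l * (2 * ∑ m, a x l m * baseSpray a m x y)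
      = (1 / 2 : ℝ) * ∑ k, y k * pd k (fun x => quad a x y) x := by
    simp only [h.lower_baseSpray hx, mul_sub, Finset.sum_sub_distrib, h1]
    rw [show ∑ l, y l * ((1 / 2 : ℝ) * pd l (fun x => quad a x y) x)
      = (1 / 2 : ℝ) * ∑ k, y k * pd k (fun x => quad a x y) x by
        rw [Finset.mul_sum]; exact Finset.sum_congr rfl fun k _ => by ring]
    ring
  rw [h.sum_low_mul]
  have h3 : ∑ l, y l * (2 * ∑ m, a x l m * baseSpray a m x y)
    = 2 * ∑ l, y l * ∑ m, a x l m * baseSpray a m x y := by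
    rw [Finset.mul_sum]; exact Finset.sum_congr rfl fun k _ => by ring
  linarith

theorem sLow_eq (h : IsRandersOn a b U) (i j : Fin n) (x : Coord n) :
    sLow a b i j x = (1 / 2 : ℝ) * (pd j (b i) x - pd i (b j) x) := by
  simp only [sLow, covDerivForm, h.christoffel_symm _ j i]
  ring

theorem lower_sMix (h : IsRandersOn a b U) (hx : x ∈ U) (l p : Fin n) :
    ∑ m, a x l m * sMix a b m p x = sLow a b l p x :=
  h.sum_mul_sum_inv hx l fun k => sLow a b k p x

theorem lower_mix0 (h : IsRandersOn a b U) (hx : x ∈ U) (l : Fin n) (y : Coord n) :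
    ∑ m, a x l m * mix0 a b m x y = low0 a b l x y := by
  simp only [mix0, low0, ← h.lower_sMix hx, Finset.mul_sum, Finset.sum_mul]
  rw [Finset.sum_comm]
  exact Finset.sum_congr rfl fun i _ => Finset.sum_congr rfl fun j _ => by ring

theorem sum_low_mul_mix0 (h : IsRandersOn a b U) (hx : x ∈ U) (y : Coord n) :
    ∑ i, low a i x y * mix0 a b i x y = 0 := by
  rw [h.sum_low_mul, ← sum_low0_mul_self a b x y]
  exact Finset.sum_congr rfl fun i _ => by rw [h.lower_mix0 hx, mul_comm]

theorem sum_riemGrad_mul_self (h : IsRandersOn a b U) (hx : x ∈ U) (hy : y ≠ 0) :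
    ∑ m, riemGrad a m x y * y m = riem a x y := by
  rw [sum_riemGrad_mul, ← quad_eq_sum_low, ← h.riem_sq hx hy, sq,
    mul_div_cancel_right₀ _ (h.riem_pos hx hy).ne']

theorem sum_riemHess_mul_self (h : IsRandersOn a b U) (hx : x ∈ U) (hy : y ≠ 0) (l : Fin n) :
    ∑ m, riemHess a l m x y * y m = 0 := by
  have := h.riem_pos hx hy
  rw [sum_riemHess_mul, ← quad_eq_sum_low, ← h.riem_sq hx hy]
  change low a l x y / _ - _ = 0
  field_simp
  ring

theorem riemHess_symm (h : IsRandersOn a b U) (i j : Fin n) (x y : Coord n) :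
    riemHess a i j x y = riemHess a j i x y := by
  rw [riemHess, riemHess, h.symm x i j, mul_comm (low a i x y)]

/-- `y^k ∂_k α = 2 α_{y^m} Ḡ^m`: the geodesic spray of `α` preserves `α`. -/
theorem sum_pd_base_riem (h : IsRandersOn a b U) (hx : x ∈ U) (hy : y ≠ 0) :
    ∑ k, y k * pd k (fun x => riem a x y) x = 2 * ∑ m, riemGrad a m x y * baseSpray a m x y := by
  have := h.riem_pos hx hy
  simp only [h.pd_base_riem hx hy]
  have h1 : ∑ k, y k * (pd k (fun x => quad a x y) x / (2 * riem a x y))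
      = (∑ k, y k * pd k (fun x => quad a x y) x) / (2 * riem a x y) := by
    rw [Finset.sum_div]; exact Finset.sum_congr rfl fun k _ => by ring
  rw [h1, h.sum_baseSpray_low hx, sum_riemGrad_mul]
  field_simp
  ring

/-- The Euler-Lagrange equation for `α`. -/
theorem sum_pd_base_riemGrad (h : IsRandersOn a b U) (hx : x ∈ U) (hy : y ≠ 0) (l : Fin n) :
    ∑ k, y k * pd k (fun x => riemGrad a l x y) x - pd l (fun x => riem a x y) x
      = 2 * ∑ m, riemHess a l m x y * baseSpray a m x y := by
  have := h.riem_pos hx hy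
  simp only [h.pd_base_riemGrad hx hy]
  have h1 : ∑ k, y k * (pd k (fun x => low a l x y) x / riem a x y
        - low a l x y * pd k (fun x => riem a x y) x / riem a x y ^ 2)
      = (∑ k, y k * pd k (fun x => low a l x y) x) / riem a x y
        - low a l x y * (∑ k, y k * pd k (fun x => riem a x y) x) / riem a x y ^ 2 := by
    simp only [mul_sub, Finset.sum_sub_distrib, Finset.mul_sum, Finset.sum_div]
    congr 1 <;> exact Finset.sum_congr rfl fun i _ => by ring
  have h2 := h.lower_baseSpray hx l y
  rw [h1, h.sum_pd_base_riem hx hy, sum_riemGrad_mul, sum_riemHess_mul, h.pd_base_riem hx hy,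
    show ∑ m, a x l m * baseSpray a m x y = (∑ k, y k * pd k (fun x => low a l x y) x
      - (1 / 2 : ℝ) * pd l (fun x => quad a x y) x) / 2 by linarith]
  field_simp
  ring

theorem sum_pd_form (h : IsRandersOn a b U) (hx : x ∈ U) (l : Fin n) (y : Coord n) :
    ∑ k, y k * pd k (b l) x - pd l (fun x => contr b x y) x = 2 * low0 a b l x y := by
  simp only [pd_base_contr (h.diff_form hx), low0, h.sLow_eq, Finset.mul_sum, ← Finset.sum_sub_distrib]
  exact Finset.sum_congr rfl fun j _ => by ring

/-- `F_{y^i} v^i` for the vector `v = Ḡ + α s_0 + P y`. -/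
theorem sum_grad_spray (h : IsRandersOn a b U) (hx : x ∈ U) (hy : y ≠ 0) :
    ∑ m, (riemGrad a m x y + b m x) *
        (baseSpray a m x y + riem a x y * mix0 a b m x y + projFactor a b x y * y m)
      = ∑ m, riemGrad a m x y * baseSpray a m x y + ∑ m, b m x * baseSpray a m x y
        + sym00 a b x y / 2 := by
  have hF := h.pos x hx y hy
  have h1 : ∀ m, (riemGrad a m x y + b m x) *
        (baseSpray a m x y + riem a x y * mix0 a b m x y + projFactor a b x y * y m)
      = riemGrad a m x y * baseSpray a m x y + b m x * baseSpray a m x y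
        + riem a x y * (riemGrad a m x y * mix0 a b m x y) + riem a x y * (b m x * mix0 a b m x y)
        + projFactor a b x y * (riemGrad a m x y * y m)
        + projFactor a b x y * (b m x * y m) := fun m => by ring
  simp only [h1, Finset.sum_add_distrib, ← Finset.mul_sum, sum_form_mul_mix0,
    h.sum_riemGrad_mul_self hx hy]
  rw [sum_riemGrad_mul (fun m => mix0 a b m x y), h.sum_low_mul_mix0 hx]
  change _ + _ + projFactor a b x y * contr b x y = _
  have h2 : projFactor a b x y * (riem a x y + contr b x y)
      = (sym00 a b x y - 2 * riem a x y * contr (sForm a b) x y) / 2 := by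
    change projFactor a b x y * randers a b x y = _
    rw [projFactor]; field_simp
  linear_combination h2

/-- `α_{y^l y^i} v^i` for the vector `v = Ḡ + α s_0 + P y`. -/
theorem sum_hess_spray (h : IsRandersOn a b U) (hx : x ∈ U) (hy : y ≠ 0) (l : Fin n) :
    ∑ m, riemHess a l m x y *
        (baseSpray a m x y + riem a x y * mix0 a b m x y + projFactor a b x y * y m)
      = ∑ m, riemHess a l m x y * baseSpray a m x y + low0 a b l x y := by
  have hα := h.riem_pos hx hy
  have h1 : ∀ m, riemHess a l m x y *
        (baseSpray a m x y + riem a x y * mix0 a b m x y + projFactor a b x y * y m)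
      = riemHess a l m x y * baseSpray a m x y
        + riem a x y * (riemHess a l m x y * mix0 a b m x y)
        + projFactor a b x y * (riemHess a l m x y * y m) := fun m => by ring
  simp only [h1, Finset.sum_add_distrib, ← Finset.mul_sum, h.sum_riemHess_mul_self hx hy]
  rw [sum_riemHess_mul l (fun m => mix0 a b m x y), h.sum_low_mul_mix0 hx, h.lower_mix0 hx]
  field_simp
  ring

theorem sum_fundTensor_mul (h : IsRandersOn a b U) (hx : x ∈ U) (hy : y ≠ 0) (l : Fin n)
    (v : Fin n → ℝ) :
    ∑ m, fundTensor (randers a b) x y l m * v m =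
      (riemGrad a l x y + b l x) * ∑ m, (riemGrad a m x y + b m x) * v m
        + randers a b x y * ∑ m, riemHess a l m x y * v m := by
  rw [Finset.mul_sum, Finset.mul_sum, ← Finset.sum_add_distrib]
  exact Finset.sum_congr rfl fun m _ => by rw [h.fundTensor_randers hx hy]; ring

theorem sum_grad_mul_self (h : IsRandersOn a b U) (hx : x ∈ U) (hy : y ≠ 0) :
    ∑ m, (riemGrad a m x y + b m x) * y m = randers a b x y := by
  simp only [add_mul, Finset.sum_add_distrib, h.sum_riemGrad_mul_self hx hy]
  rfl

theorem sum_fundTensor_mul_self (h : IsRandersOn a b U) (hx : x ∈ U) (hy : y ≠ 0) (l : Fin n) :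
    ∑ m, fundTensor (randers a b) x y l m * y m =
      randers a b x y * (riemGrad a l x y + b l x) := by
  rw [h.sum_fundTensor_mul hx hy, h.sum_riemHess_mul_self hx hy, h.sum_grad_mul_self hx hy]
  ring

/-- The fundamental tensor is nondegenerate: if `g_{lm} v^m = 0`, contracting with `y^l` gives
`F_{y^m} v^m = 0`, so `v` lies in the kernel of the Hessian of `α`, the line spanned by `y`, on
which `F_{y^m}` does not vanish. -/
theorem isUnit_det_fundTensor (h : IsRandersOn a b U) (hx : x ∈ U) (hy : y ≠ 0) :
    IsUnit (fundTensor (randers a b) x y).det := by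
  have hα := h.riem_pos hx hy
  have hF := h.pos x hx y hy
  rw [isUnit_iff_ne_zero]
  intro h0
  obtain ⟨v, hv, hgv⟩ := Matrix.exists_mulVec_eq_zero_iff.2 h0
  apply hv
  have h1 : ∀ l, (riemGrad a l x y + b l x) * ∑ m, (riemGrad a m x y + b m x) * v m
        + randers a b x y * ∑ m, riemHess a l m x y * v m = 0 := fun l => by
    rw [← h.sum_fundTensor_mul hx hy]; exact congrFun hgv l
  have h2 : ∑ m, (riemGrad a m x y + b m x) * v m = 0 := by
    have h3 : ∑ l, y l * ((riemGrad a l x y + b l x) * ∑ m, (riemGrad a m x y + b m x) * v m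
        + randers a b x y * ∑ m, riemHess a l m x y * v m) = 0 := by simp [h1]
    have h4 : ∑ l, y l * ∑ m, riemHess a l m x y * v m = 0 := by
      simp only [Finset.mul_sum]
      rw [Finset.sum_comm]
      refine Finset.sum_eq_zero fun m _ => ?_
      have := h.sum_riemHess_mul_self hx hy m
      rw [← zero_mul (v m), ← this, Finset.sum_mul]
      exact Finset.sum_congr rfl fun l _ => by rw [h.riemHess_symm l m]; ring
    have h5 : ∑ l, y l * ((riemGrad a l x y + b l x) * ∑ m, (riemGrad a m x y + b m x) * v m
        + randers a b x y * ∑ m, riemHess a l m x y * v m)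
        = (∑ l, (riemGrad a l x y + b l x) * y l) * ∑ m, (riemGrad a m x y + b m x) * v m
        + randers a b x y * ∑ l, y l * ∑ m, riemHess a l m x y * v m := by
      rw [Finset.sum_mul, Finset.mul_sum, ← Finset.sum_add_distrib]
      exact Finset.sum_congr rfl fun l _ => by ring
    rw [h5, h4, h.sum_grad_mul_self hx hy, mul_zero, add_zero] at h3
    exact (mul_eq_zero.1 h3).resolve_left hF.ne'
  set t : ℝ := (∑ m, low a m x y * v m) / riem a x y ^ 2 with ht
  have h3 : ∀ l, ∑ m, a x l m * v m = t * low a l x y := fun l => by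
    have := h1 l
    rw [h2, mul_zero, zero_add, mul_eq_zero, or_iff_right hF.ne', sum_riemHess_mul] at this
    rw [ht]
    field_simp at this ⊢
    linear_combination this
  have h4 : WithLp.toLp 2 v - t • y = 0 := h.eq_zero_of_low_eq_zero hx fun l => by
    have h5 := h3 l
    simp only [low, Finset.mul_sum] at h5 ⊢
    simp only [PiLp.sub_apply, PiLp.smul_apply, smul_eq_mul, mul_sub, Finset.sum_sub_distrib, h5]
    rw [sub_eq_zero]
    exact Finset.sum_congr rfl fun l _ => by ring
  have h5 : ∀ m, v m = t * y m := fun m => by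
    simpa using congrArg (fun w : Coord n => w m) (sub_eq_zero.1 h4)
  have h6 : t = 0 := by
    have : ∑ m, (riemGrad a m x y + b m x) * v m = t * randers a b x y := by
      rw [← h.sum_grad_mul_self hx hy, Finset.mul_sum]
      exact Finset.sum_congr rfl fun m _ => by rw [h5]; ring
    rw [h2] at this
    exact (mul_eq_zero.1 this.symm).resolve_right hF.ne'
  funext m
  simp [h5, h6]

theorem diff_fundTensor (h : IsRandersOn a b U) (hx : x ∈ U) (hy : y ≠ 0) (i j : Fin n) :
    DifferentiableAt ℝ (fun x => fundTensor (randers a b) x y i j) x := by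
  refine DifferentiableAt.congr_of_eventuallyEq ?_ (Filter.eventuallyEq_of_mem
    (h.isOpen.mem_nhds hx) fun x' hx' => h.fundTensor_randers hx' hy i j)
  exact (((h.diff_riemGrad hx hy i).add (h.diff_form hx i)).mul
    ((h.diff_riemGrad hx hy j).add (h.diff_form hx j))).add
      ((h.diff_randers hx hy).mul (h.diff_riemHess hx hy i j))

theorem fundTensor_symm (h : IsRandersOn a b U) (hx : x ∈ U) (hy : y ≠ 0) (i j : Fin n) :
    fundTensor (randers a b) x y i j = fundTensor (randers a b) x y j i := by
  rw [h.fundTensor_randers hx hy, h.fundTensor_randers hx hy, h.riemHess_symm i j]; ring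

/-- `(2 ∂_k g_{jl} - ∂_l g_{jk}) y^j y^k = 2 y^k ∂_k (F F_{y^l}) - ∂_l F²`. -/
theorem sum_pd_fundTensor (h : IsRandersOn a b U) (hx : x ∈ U) (hy : y ≠ 0) (l : Fin n) :
    ∑ j, ∑ k, (2 * pd k (fun x' => fundTensor (randers a b) x' y j l) x
      - pd l (fun x' => fundTensor (randers a b) x' y j k) x) * y j * y k
    = 2 * ∑ k, y k * pd k (fun x => randers a b x y * (riemGrad a l x y + b l x)) x
      - pd l (fun x => randers a b x y * randers a b x y) x := by
  have hd := h.diff_fundTensor hx hy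
  have h1 : ∀ k, pd k (fun x => randers a b x y * (riemGrad a l x y + b l x)) x
      = ∑ j, pd k (fun x' => fundTensor (randers a b) x' y j l) x * y j := fun k => by
    rw [← pd_congr_of_isOpen h.isOpen hx fun x' hx' =>
      (show ∑ j, fundTensor (randers a b) x' y j l * y j = _ by
        rw [← h.sum_fundTensor_mul_self hx' hy]
        exact Finset.sum_congr rfl fun j _ => by rw [h.fundTensor_symm hx' hy]),
      pd_sum fun j _ => (hd j l).mul_const _]
    exact Finset.sum_congr rfl fun j _ => pd_mul_const (hd j l) _
  have h2 : pd l (fun x => randers a b x y * randers a b x y) x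
      = ∑ j, ∑ k, pd l (fun x' => fundTensor (randers a b) x' y j k) x * y k * y j := by
    rw [← pd_congr_of_isOpen h.isOpen hx fun x' hx' =>
      (show ∑ j, ∑ k, fundTensor (randers a b) x' y j k * y k * y j = _ by
        simp only [← Finset.sum_mul, h.sum_fundTensor_mul_self hx' hy]
        rw [← h.sum_grad_mul_self hx' hy, Finset.mul_sum]
        refine Finset.sum_congr rfl fun j _ => ?_
        rw [h.sum_grad_mul_self hx' hy]; ring),
      pd_sum fun j _ => DifferentiableAt.fun_sum fun k _ => ((hd j k).mul_const _).mul_const _]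
    refine Finset.sum_congr rfl fun j _ => ?_
    rw [pd_sum fun k _ => ((hd j k).mul_const _).mul_const _]
    refine Finset.sum_congr rfl fun k _ => ?_
    rw [pd_mul_const ((hd j k).mul_const _), pd_mul_const (hd j k)]
  have h3 : ∑ k, y k * pd k (fun x => randers a b x y * (riemGrad a l x y + b l x)) x
      = ∑ j, ∑ k, pd k (fun x' => fundTensor (randers a b) x' y j l) x * y j * y k := by
    simp only [h1, Finset.mul_sum]
    rw [Finset.sum_comm]
    exact Finset.sum_congr rfl fun j _ => Finset.sum_congr rfl fun k _ => by ring
  rw [h2, h3, Finset.mul_sum, ← Finset.sum_sub_distrib]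
  refine Finset.sum_congr rfl fun j _ => ?_
  rw [Finset.mul_sum, ← Finset.sum_sub_distrib]
  exact Finset.sum_congr rfl fun k _ => by ring

/-- The geodesic coefficients of a Randers metric. -/
theorem geodesicCoeff_randers (h : IsRandersOn a b U) (hx : x ∈ U) (hy : y ≠ 0) (i : Fin n) :
    geodesicCoeff (randers a b) i x y =
      baseSpray a i x y + riem a x y * mix0 a b i x y + projFactor a b x y * y i := by
  set W : Fin n → ℝ := fun i =>
    baseSpray a i x y + riem a x y * mix0 a b i x y + projFactor a b x y * y i with hW
  have hdα := h.diff_riem hx hy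
  have hdβ := diff_base_contr (h.diff_form hx) y
  have hdF := h.diff_randers hx hy
  have key : ∀ l, ∑ j, ∑ k, (2 * pd k (fun x' => fundTensor (randers a b) x' y j l) x
      - pd l (fun x' => fundTensor (randers a b) x' y j k) x) * y j * y k
      = 4 * ∑ m, fundTensor (randers a b) x y l m * W m := fun l => by
    have hdg := (h.diff_riemGrad hx hy l).fun_add (h.diff_form hx l)
    have hF : ∀ k, pd k (fun x => randers a b x y) x
        = pd k (fun x => riem a x y) x + pd k (fun x => contr b x y) x := fun k =>
      pd_add hdα hdβ
    have h1 : ∑ k, y k * pd k (fun x => randers a b x y * (riemGrad a l x y + b l x)) x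
        = (∑ k, y k * pd k (fun x => riem a x y) x + ∑ k, y k * pd k (fun x => contr b x y) x)
            * (riemGrad a l x y + b l x)
          + randers a b x y * (∑ k, y k * pd k (fun x => riemGrad a l x y) x
            + ∑ k, y k * pd k (b l) x) := by
      simp only [pd_mul hdF hdg, pd_add (h.diff_riemGrad hx hy l) (h.diff_form hx l), hF]
      simp only [← Finset.sum_add_distrib, Finset.sum_mul, Finset.mul_sum]
      exact Finset.sum_congr rfl fun k _ => by ring
    rw [h.sum_pd_fundTensor hx hy, h1, pd_mul hdF hdF, hF, h.sum_fundTensor_mul hx hy,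
      h.sum_grad_spray hx hy, h.sum_hess_spray hx hy, h.sum_pd_base_riem hx hy,
      sum_pd_base_contr a (h.diff_form hx)]
    linear_combination (2 * randers a b x y) * h.sum_pd_base_riemGrad hx hy l
      + (2 * randers a b x y) * h.sum_pd_form hx l y
  have h2 : (fundTensor (randers a b) x y)⁻¹ *ᵥ (fundTensor (randers a b) x y *ᵥ W) = W := by
    rw [Matrix.mulVec_mulVec, Matrix.nonsing_inv_mul _ (h.isUnit_det_fundTensor hx hy),
      Matrix.one_mulVec]
  rw [geodesicCoeff]
  simp only [key]
  have h3 := congrFun h2 i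
  change ∑ l, (fundTensor (randers a b) x y)⁻¹ i l
    * ∑ m, fundTensor (randers a b) x y l m * W m = W i at h3
  change _ = W i
  rw [← h3, Finset.mul_sum]
  exact Finset.sum_congr rfl fun l _ => by ring

end IsRandersOn

/-! ### Vanishing S-curvature -/

/-- The nonlinear connection coefficients `∂Ḡ^i/∂y^k = Γ^i_{kj} y^j` of a Riemannian metric. -/
def baseConn (a : Coord n → Matrix (Fin n) (Fin n) ℝ) (i k : Fin n) (x y : Coord n) : ℝ :=
  ∑ j, christoffel a i k j x * y j

/-- Euler's identity for positively 1-homogeneous functions. -/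
theorem sum_mul_pd_of_homogeneous {f : Coord n → ℝ} (hf : DifferentiableAt ℝ f y)
    (hom : ∀ t : ℝ, 0 < t → f (t • y) = t * f y) : ∑ i, y i * pd i f y = f y := by
  have h1 : ∑ i, y i * pd i f y = fderiv ℝ f y y := by
    conv_rhs => rw [← congrArg (fderiv ℝ f y) (sum_smul_single y)]
    simp [pd]
  have h2 : HasDerivAt (fun t : ℝ => f (t • y)) (fderiv ℝ f y y) 1 := by
    have h3 : HasDerivAt (fun t : ℝ => t • y) y 1 := by
      simpa using (hasDerivAt_id (1 : ℝ)).smul_const y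
    have h4 : HasFDerivAt f (fderiv ℝ f y) ((1 : ℝ) • y) := by
      rw [one_smul]; exact hf.hasFDerivAt
    exact h4.comp_hasDerivAt (1 : ℝ) h3
  have h3 : HasDerivAt (fun t : ℝ => f (t • y)) (f y) 1 := by
    have h4 : HasDerivAt (fun t : ℝ => t * f y) (f y) 1 := by
      simpa using (hasDerivAt_id (1 : ℝ)).mul_const (f y)
    refine h4.congr_of_eventuallyEq ?_
    filter_upwards [lt_mem_nhds (one_pos : (0 : ℝ) < 1)] with t ht using hom t ht
  rw [h1, h2.unique h3]

theorem quad_smul (a : Coord n → Matrix (Fin n) (Fin n) ℝ) (t : ℝ) (x y : Coord n) :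
    quad a x (t • y) = t ^ 2 * quad a x y := by
  simp only [quad, PiLp.smul_apply, smul_eq_mul, Finset.mul_sum]
  exact Finset.sum_congr rfl fun i _ => Finset.sum_congr rfl fun j _ => by ring

theorem riem_smul (a : Coord n → Matrix (Fin n) (Fin n) ℝ) (t : ℝ) (x y : Coord n) :
    riem a x (t • y) = |t| * riem a x y := by
  rw [riem, quad_smul, Real.sqrt_mul (sq_nonneg t), Real.sqrt_sq_eq_abs, riem]

theorem contr_smul (w : Fin n → Coord n → ℝ) (t : ℝ) (x y : Coord n) :
    contr w x (t • y) = t * contr w x y := by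
  simp only [contr, PiLp.smul_apply, smul_eq_mul, Finset.mul_sum]
  exact Finset.sum_congr rfl fun i _ => by ring

theorem sym00_smul (a : Coord n → Matrix (Fin n) (Fin n) ℝ) (w : Fin n → Coord n → ℝ) (t : ℝ)
    (x y : Coord n) : sym00 a w x (t • y) = t ^ 2 * sym00 a w x y := by
  simp only [sym00, PiLp.smul_apply, smul_eq_mul, Finset.mul_sum]
  exact Finset.sum_congr rfl fun i _ => Finset.sum_congr rfl fun j _ => by ring

theorem riem_neg (a : Coord n → Matrix (Fin n) (Fin n) ℝ) (x y : Coord n) :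
    riem a x (-y) = riem a x y := by
  simpa using riem_smul a (-1) x y

theorem contr_neg (w : Fin n → Coord n → ℝ) (x y : Coord n) :
    contr w x (-y) = -contr w x y := by
  simpa using contr_smul w (-1) x y

theorem sym00_neg (a : Coord n → Matrix (Fin n) (Fin n) ℝ) (w : Fin n → Coord n → ℝ)
    (x y : Coord n) : sym00 a w x (-y) = sym00 a w x y := by
  simpa using sym00_smul a w (-1) x y

theorem baseConn_neg (a : Coord n → Matrix (Fin n) (Fin n) ℝ) (i k : Fin n) (x y : Coord n) :
    baseConn a i k x (-y) = -baseConn a i k x y := by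
  simp [baseConn]

theorem baseSpray_neg (a : Coord n → Matrix (Fin n) (Fin n) ℝ) (i : Fin n) (x y : Coord n) :
    baseSpray a i x (-y) = baseSpray a i x y := by
  simp [baseSpray]

theorem diff_vert_baseSpray (a : Coord n → Matrix (Fin n) (Fin n) ℝ) (i : Fin n)
    (x y : Coord n) : DifferentiableAt ℝ (fun y => baseSpray a i x y) y := by
  unfold baseSpray; fun_prop

theorem diff_vert_mix0 (a : Coord n → Matrix (Fin n) (Fin n) ℝ) (b : Fin n → Coord n → ℝ)
    (i : Fin n) (x y : Coord n) : DifferentiableAt ℝ (fun y => mix0 a b i x y) y := by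
  unfold mix0; fun_prop

theorem pd_vert_mix0 (a : Coord n → Matrix (Fin n) (Fin n) ℝ) (b : Fin n → Coord n → ℝ)
    (k i : Fin n) (x y : Coord n) : pd k (fun y => mix0 a b i x y) y = sMix a b i k x :=
  pd_linear k _ y

namespace IsRandersOn

theorem pd_vert_baseSpray (h : IsRandersOn a b U) (k i : Fin n) (x y : Coord n) :
    pd k (fun y => baseSpray a i x y) y = baseConn a i k x y := by
  unfold baseSpray
  rw [pd_const_mul (by fun_prop), pd_quadratic k _ fun j k => h.christoffel_symm i j k x, baseConn]
  ring

/-- `s^i_i = 0`, because `a^{ij}` is symmetric and `s_{ij}` antisymmetric. -/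
theorem sum_sMix_self (h : IsRandersOn a b U) (x : Coord n) : ∑ i, sMix a b i i x = 0 := by
  have hs : ∀ i j, (a x)⁻¹ i j = (a x)⁻¹ j i := fun i j => by
    have : (a x)ᵀ = a x := by ext i j; exact h.symm x j i
    conv_lhs => rw [← this, ← Matrix.transpose_nonsing_inv]
    rfl
  have h1 : ∑ i, sMix a b i i x = -∑ i, sMix a b i i x := by
    conv_lhs => simp only [sMix]
    rw [Finset.sum_comm, ← Finset.sum_neg_distrib]
    refine Finset.sum_congr rfl fun i _ => ?_
    rw [sMix, ← Finset.sum_neg_distrib]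
    refine Finset.sum_congr rfl fun j _ => ?_
    rw [sLow_antisymm a b i j, hs j i]; ring
  linarith

/-- `∂(α s^i_0)/∂y^i = 0`. -/
theorem sum_pd_riem_mul_mix0 (h : IsRandersOn a b U) (hx : x ∈ U) (hy : y ≠ 0) :
    ∑ i, pd i (fun y => riem a x y * mix0 a b i x y) y = 0 := by
  have h1 : ∀ i, pd i (fun y => riem a x y * mix0 a b i x y) y
      = riemGrad a i x y * mix0 a b i x y + riem a x y * sMix a b i i x := fun i => by
    rw [pd_mul (h.diff_vert_riem hx hy) (diff_vert_mix0 a b i x y), h.pd_vert_riem hx hy,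
      pd_vert_mix0]
  simp only [h1, Finset.sum_add_distrib, ← Finset.mul_sum, h.sum_sMix_self]
  rw [sum_riemGrad_mul (fun i => mix0 a b i x y), h.sum_low_mul_mix0 hx]
  simp

theorem diff_vert_projFactor (h : IsRandersOn a b U) (hx : x ∈ U) (hy : y ≠ 0) :
    DifferentiableAt ℝ (fun y => projFactor a b x y) y := by
  have h1 : DifferentiableAt ℝ (fun y => sym00 a b x y) y := by unfold sym00; fun_prop
  have h2 := h.diff_vert_riem hx hy
  exact differentiableAt_fun_div
    (h1.sub ((h2.const_mul 2).mul (diff_vert_contr _ x y)))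
    ((h2.add (diff_vert_contr b x y)).const_mul 2)
    (mul_pos two_pos (h.pos x hx y hy)).ne'

theorem projFactor_smul (h : IsRandersOn a b U) (hx : x ∈ U) (hy : y ≠ 0) {t : ℝ} (ht : 0 < t) :
    projFactor a b x (t • y) = t * projFactor a b x y := by
  have hF := h.pos x hx y hy
  unfold projFactor
  have h1 : randers a b x (t • y) = t * randers a b x y := by
    rw [randers, riem_smul, contr_smul, abs_of_pos ht, randers]; ring
  rw [h1, riem_smul, contr_smul, sym00_smul, abs_of_pos ht]
  field_simp

/-- `∂G^i/∂y^i = Γ^i_{ij} y^j + (n + 1) P`. -/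
theorem sum_pd_geodesicCoeff (h : IsRandersOn a b U) (hx : x ∈ U) (hy : y ≠ 0) :
    ∑ i, pd i (fun y' => geodesicCoeff (randers a b) i x y') y
      = ∑ i, baseConn a i i x y + ((n : ℝ) + 1) * projFactor a b x y := by
  have hP := h.diff_vert_projFactor hx hy
  have h1 : ∀ i, pd i (fun y' => geodesicCoeff (randers a b) i x y') y
      = baseConn a i i x y + pd i (fun y => riem a x y * mix0 a b i x y) y
        + (y i * pd i (fun y => projFactor a b x y) y + projFactor a b x y) := fun i => by
    have d2 := (h.diff_vert_riem hx hy).fun_mul (diff_vert_mix0 a b i x y)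
    rw [pd_congr_of_isOpen isOpen_ne hy fun y' hy' => h.geodesicCoeff_randers hx hy' i,
      pd_add ((diff_vert_baseSpray a i x y).fun_add d2) (hP.fun_mul (differentiableAt_coord i y)),
      pd_add (diff_vert_baseSpray a i x y) d2, h.pd_vert_baseSpray,
      pd_mul hP (differentiableAt_coord i y), pd_coord]
    simp only [if_true]; ring
  simp only [h1, Finset.sum_add_distrib, h.sum_pd_riem_mul_mix0 hx hy,
    sum_mul_pd_of_homogeneous hP fun t ht => h.projFactor_smul hx hy ht]
  simp; ring

/-- Vanishing S-curvature forces `r_{00} = -2 β s_0`. In `S = (n + 1) P + (linear in y)` the linear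
term, which contains the volume density, is odd in `y`, so `P(y) + P(-y) = 0`. -/
theorem sym00_eq_of_SCurv (h : IsRandersOn a b U) (hx : x ∈ U) (hy : y ≠ 0)
    (hS : ∀ y : Coord n, y ≠ 0 → SCurv (randers a b) x y = 0) :
    sym00 a b x y = -2 * contr b x y * contr (sForm a b) x y := by
  have h1 := hS y hy
  have h2 := hS (-y) (neg_ne_zero.2 hy)
  rw [SCurv, h.sum_pd_geodesicCoeff hx hy] at h1
  rw [SCurv, h.sum_pd_geodesicCoeff hx (neg_ne_zero.2 hy)] at h2
  simp only [baseConn_neg, PiLp.neg_apply, neg_mul, Finset.sum_neg_distrib] at h2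
  have hn : ((n : ℝ) + 1) ≠ 0 := by positivity
  have h3 : projFactor a b x y + projFactor a b x (-y) = 0 := by
    apply (mul_eq_zero.1 (_ : ((n : ℝ) + 1) * _ = 0)).resolve_left hn
    linear_combination h1 + h2
  have hα := h.riem_pos hx hy
  have hF := h.pos x hx y hy
  have hF' := h.pos x hx (-y) (neg_ne_zero.2 hy)
  rw [randers, riem_neg, contr_neg] at hF'
  rw [randers] at hF
  simp only [projFactor, randers, sym00_neg, riem_neg, contr_neg] at h3
  rw [div_add_div _ _ (by positivity) (by positivity), div_eq_zero_iff,
    or_iff_left (by positivity)] at h3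
  apply mul_left_cancel₀ hα.ne'
  linear_combination h3 / 4

theorem projFactor_eq (h : IsRandersOn a b U) (hx : x ∈ U) (hy : y ≠ 0)
    (hr : sym00 a b x y = -2 * contr b x y * contr (sForm a b) x y) :
    projFactor a b x y = -contr (sForm a b) x y := by
  have hF := h.pos x hx y hy
  rw [projFactor, hr, div_eq_iff (by positivity), randers]
  ring

end IsRandersOn

/-! ### Ricci curvature -/

/-- The Ricci curvature in terms of an explicit formula `K` for the geodesic coefficients, their
vertical derivatives `N^i_k = ∂K^i/∂y^k`, and the divergence `T = N^i_i`. -/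
theorem ricciCurv_of_geodesicCoeff {F : Coord n → Coord n → ℝ} (hU : IsOpen U) (hx : x ∈ U)
    (hy : y ≠ 0) (K : Fin n → Coord n → Coord n → ℝ) (N : Fin n → Fin n → Coord n → Coord n → ℝ)
    (T : Coord n → Coord n → ℝ)
    (hK : ∀ x ∈ U, ∀ y : Coord n, y ≠ 0 → ∀ i, geodesicCoeff F i x y = K i x y)
    (hN : ∀ x ∈ U, ∀ y : Coord n, y ≠ 0 → ∀ i k, pd k (fun y => K i x y) y = N i k x y)
    (hT : ∀ x ∈ U, ∀ y : Coord n, y ≠ 0 → ∑ i, N i i x y = T x y)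
    (hNx : ∀ i, DifferentiableAt ℝ (fun x => N i i x y) x)
    (hNy : ∀ i, DifferentiableAt ℝ (fun y => N i i x y) y) :
    ricciCurv F x y = 2 * ∑ i, pd i (fun x => K i x y) x - ∑ j, y j * pd j (fun x => T x y) x
      + 2 * ∑ j, K j x y * pd j (fun y => T x y) y - ∑ i, ∑ j, N i j x y * N j i x y := by
  have hN' : ∀ x ∈ U, ∀ y : Coord n, y ≠ 0 → ∀ i k,
      pd k (fun y => geodesicCoeff F i x y) y = N i k x y := fun x hx y hy i k => by
    rw [pd_congr_of_isOpen isOpen_ne hy fun y' hy' => hK x hx y' hy' i, hN x hx y hy]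
  have h1 : ∀ i, riemannCurv F i i x y = 2 * pd i (fun x => K i x y) x
      - ∑ j, y j * pd j (fun x => N i i x y) x
      + 2 * ∑ j, K j x y * pd j (fun y => N i i x y) y - ∑ j, N i j x y * N j i x y := fun i => by
    simp only [riemannCurv, hN' x hx y hy, hK x hx y hy]
    rw [pd_congr_of_isOpen hU hx fun x' hx' => hK x' hx' y hy i]
    congr 2
    · congr 1
      exact Finset.sum_congr rfl fun j _ => by
        rw [pd_congr_of_isOpen hU hx fun x' hx' => hN' x' hx' y hy i i]
    · congr 1
      exact Finset.sum_congr rfl fun j _ => by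
        rw [pd_congr_of_isOpen isOpen_ne hy fun y' hy' => hN' x hx y' hy' i i]
  have h2 : ∀ j, pd j (fun x => T x y) x = ∑ i, pd j (fun x => N i i x y) x := fun j => by
    rw [← pd_sum fun i _ => hNx i, pd_congr_of_isOpen hU hx fun x' hx' => (hT x' hx' y hy).symm]
  have h3 : ∀ j, pd j (fun y => T x y) y = ∑ i, pd j (fun y => N i i x y) y := fun j => by
    rw [← pd_sum fun i _ => hNy i,
      pd_congr_of_isOpen isOpen_ne hy fun y' hy' => (hT x hx y' hy').symm]
  simp only [ricciCurv, h1, h2, h3, Finset.sum_add_distrib, Finset.sum_sub_distrib,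
    Finset.mul_sum]
  rw [Finset.sum_comm (f := fun j i => y j * pd j (fun x => N i i x y) x),
    Finset.sum_comm (f := fun j i => 2 * (K j x y * pd j (fun y => N i i x y) y))]

/-- The divergence `∂Ḡ^i/∂y^i = Γ^i_{ij} y^j`. -/
def baseTr (a : Coord n → Matrix (Fin n) (Fin n) ℝ) (x y : Coord n) : ℝ :=
  ∑ i, baseConn a i i x y

/-- The deformation `Q^i = α s^i_0 - s_0 y^i` of the geodesic coefficients of `α` into those of
`α + β` when the S-curvature vanishes. -/
def sprayDiff (a : Coord n → Matrix (Fin n) (Fin n) ℝ) (b : Fin n → Coord n → ℝ) (i : Fin n)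
    (x y : Coord n) : ℝ :=
  riem a x y * mix0 a b i x y - contr (sForm a b) x y * y i

/-- The vertical derivative `∂Q^i/∂y^k`. -/
def sprayDiffGrad (a : Coord n → Matrix (Fin n) (Fin n) ℝ) (b : Fin n → Coord n → ℝ)
    (i k : Fin n) (x y : Coord n) : ℝ :=
  riemGrad a k x y * mix0 a b i x y + riem a x y * sMix a b i k x
    - sForm a b k x * y i - contr (sForm a b) x y * (if k = i then 1 else 0)

/-- The divergence `s^k_{0|k} = s^k_{p|k} y^p`. -/
def divMix0 (a : Coord n → Matrix (Fin n) (Fin n) ℝ) (b : Fin n → Coord n → ℝ)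
    (x y : Coord n) : ℝ :=
  ∑ k, ∑ p, covDerivEnd a (sMix a b) k p k x * y p

theorem sum_sForm_mul_self (a : Coord n → Matrix (Fin n) (Fin n) ℝ) (b : Fin n → Coord n → ℝ)
    (x y : Coord n) : ∑ i, sForm a b i x * y i = contr (sForm a b) x y := rfl

theorem diff_vert_baseConn (a : Coord n → Matrix (Fin n) (Fin n) ℝ) (i k : Fin n)
    (x y : Coord n) : DifferentiableAt ℝ (fun y => baseConn a i k x y) y := by
  unfold baseConn; fun_prop

theorem pd_vert_baseTr (a : Coord n → Matrix (Fin n) (Fin n) ℝ) (k : Fin n) (x y : Coord n) :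
    pd k (fun y => baseTr a x y) y = ∑ i, christoffel a i i k x := by
  unfold baseTr
  rw [pd_sum fun i _ => diff_vert_baseConn a i i x y]
  exact Finset.sum_congr rfl fun i _ => pd_linear k _ y

theorem baseTr_neg (a : Coord n → Matrix (Fin n) (Fin n) ℝ) (x y : Coord n) :
    baseTr a x (-y) = -baseTr a x y := by
  simp [baseTr, baseConn_neg]

theorem sum_baseConn_mul_self (a : Coord n → Matrix (Fin n) (Fin n) ℝ) (i : Fin n)
    (x y : Coord n) : ∑ j, baseConn a i j x y * y j = 2 * baseSpray a i x y := by
  simp only [baseConn, baseSpray, Finset.sum_mul, Finset.mul_sum]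
  exact Finset.sum_congr rfl fun i _ => Finset.sum_congr rfl fun j _ => by ring

theorem sum_mul_christoffel_self (a : Coord n → Matrix (Fin n) (Fin n) ℝ) (x y : Coord n) :
    ∑ j, y j * ∑ i, christoffel a i i j x = baseTr a x y := by
  simp only [baseTr, baseConn, Finset.mul_sum]
  rw [Finset.sum_comm]
  exact Finset.sum_congr rfl fun i _ => Finset.sum_congr rfl fun j _ => by ring

theorem mix0_neg (a : Coord n → Matrix (Fin n) (Fin n) ℝ) (b : Fin n → Coord n → ℝ) (i : Fin n)
    (x y : Coord n) : mix0 a b i x (-y) = -mix0 a b i x y := by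
  simp [mix0]

theorem low0_neg (a : Coord n → Matrix (Fin n) (Fin n) ℝ) (b : Fin n → Coord n → ℝ) (i : Fin n)
    (x y : Coord n) : low0 a b i x (-y) = -low0 a b i x y := by
  simp [low0]

theorem divMix0_neg (a : Coord n → Matrix (Fin n) (Fin n) ℝ) (b : Fin n → Coord n → ℝ)
    (x y : Coord n) : divMix0 a b x (-y) = -divMix0 a b x y := by
  simp [divMix0]

namespace IsRandersOn

theorem diff_baseConn (h : IsRandersOn a b U) (hx : x ∈ U) (i k : Fin n) (y : Coord n) :
    DifferentiableAt ℝ (fun x => baseConn a i k x y) x :=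
  DifferentiableAt.fun_sum fun j _ => (h.diff_christoffel hx i k j).mul_const _

theorem diff_baseTr (h : IsRandersOn a b U) (hx : x ∈ U) (y : Coord n) :
    DifferentiableAt ℝ (fun x => baseTr a x y) x :=
  DifferentiableAt.fun_sum fun i _ => h.diff_baseConn hx i i y

theorem diff_baseSpray (h : IsRandersOn a b U) (hx : x ∈ U) (i : Fin n) (y : Coord n) :
    DifferentiableAt ℝ (fun x => baseSpray a i x y) x :=
  (DifferentiableAt.fun_sum fun j _ => DifferentiableAt.fun_sum fun k _ =>
    ((h.diff_christoffel hx i j k).mul_const _).mul_const _).const_mul _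

theorem diff_mix0 (h : IsRandersOn a b U) (hx : x ∈ U) (i : Fin n) (y : Coord n) :
    DifferentiableAt ℝ (fun x => mix0 a b i x y) x :=
  DifferentiableAt.fun_sum fun j _ => (h.diff_sMix hx i j).mul_const _

theorem diff_sprayDiff (h : IsRandersOn a b U) (hx : x ∈ U) (hy : y ≠ 0) (i : Fin n) :
    DifferentiableAt ℝ (fun x => sprayDiff a b i x y) x :=
  ((h.diff_riem hx hy).mul (h.diff_mix0 hx i y)).sub
    ((diff_base_contr (h.diff_sForm hx) y).mul_const _)

theorem diff_vert_sprayDiff (h : IsRandersOn a b U) (hx : x ∈ U) (hy : y ≠ 0) (i : Fin n) :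
    DifferentiableAt ℝ (fun y => sprayDiff a b i x y) y :=
  ((h.diff_vert_riem hx hy).mul (diff_vert_mix0 a b i x y)).sub
    ((diff_vert_contr _ x y).mul (differentiableAt_coord i y))

theorem diff_sprayDiffGrad (h : IsRandersOn a b U) (hx : x ∈ U) (hy : y ≠ 0) (i k : Fin n) :
    DifferentiableAt ℝ (fun x => sprayDiffGrad a b i k x y) x :=
  ((((h.diff_riemGrad hx hy k).mul (h.diff_mix0 hx i y)).add
    ((h.diff_riem hx hy).mul (h.diff_sMix hx i k))).sub ((h.diff_sForm hx k).mul_const _)).sub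
      ((diff_base_contr (h.diff_sForm hx) y).mul_const _)

theorem diff_vert_sprayDiffGrad (h : IsRandersOn a b U) (hx : x ∈ U) (hy : y ≠ 0) (i k : Fin n) :
    DifferentiableAt ℝ (fun y => sprayDiffGrad a b i k x y) y :=
  ((((h.diff_vert_riemGrad hx hy k).mul (diff_vert_mix0 a b i x y)).add
    ((h.diff_vert_riem hx hy).mul_const _)).sub ((differentiableAt_coord i y).const_mul _)).sub
      ((diff_vert_contr _ x y).mul_const _)

theorem pd_vert_sprayDiff (h : IsRandersOn a b U) (hx : x ∈ U) (hy : y ≠ 0) (k i : Fin n) :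
    pd k (fun y => sprayDiff a b i x y) y = sprayDiffGrad a b i k x y := by
  have d1 := h.diff_vert_riem hx hy
  have d2 := diff_vert_mix0 a b i x y
  have d3 := diff_vert_contr (sForm a b) x y
  have d4 := differentiableAt_coord i y
  unfold sprayDiff
  rw [pd_sub (d1.fun_mul d2) (d3.fun_mul d4), pd_mul d1 d2, pd_mul d3 d4, h.pd_vert_riem hx hy,
    pd_vert_mix0, pd_vert_contr, pd_coord, sprayDiffGrad]
  ring

theorem sum_sprayDiffGrad_self (h : IsRandersOn a b U) (hx : x ∈ U) (y : Coord n) :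
    ∑ i, sprayDiffGrad a b i i x y = -((n : ℝ) + 1) * contr (sForm a b) x y := by
  simp only [sprayDiffGrad, Finset.sum_sub_distrib, Finset.sum_add_distrib, ← Finset.mul_sum,
    h.sum_sMix_self, sum_sForm_mul_self]
  rw [sum_riemGrad_mul (fun i => mix0 a b i x y), h.sum_low_mul_mix0 hx]
  simp; ring

/-- The Ricci curvature of `α`. -/
theorem ricciCurv_riem (h : IsRandersOn a b U) (hx : x ∈ U) (hy : y ≠ 0) :
    ricciCurv (riem a) x y = 2 * ∑ i, pd i (fun x => baseSpray a i x y) x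
      - ∑ j, y j * pd j (fun x => baseTr a x y) x
      + 2 * ∑ j, baseSpray a j x y * ∑ i, christoffel a i i j x
      - ∑ i, ∑ j, baseConn a i j x y * baseConn a j i x y := by
  have h0 := h.riemannian
  have hr : riem a = randers a (fun _ _ => 0) := by
    funext x y; simp [randers, contr]
  have hs : ∀ i j x, sMix a (fun _ _ => 0) i j x = 0 := fun i j x => by
    simp [sMix, h0.sLow_eq]
  rw [ricciCurv_of_geodesicCoeff h.isOpen hx hy (baseSpray a) (baseConn a) (baseTr a) ?_
    (fun x hx y hy i k => h.pd_vert_baseSpray k i x y) (fun _ _ _ _ => rfl)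
    (fun i => h.diff_baseConn hx i i y) (fun i => diff_vert_baseConn a i i x y)]
  · simp only [pd_vert_baseTr]
  · intro x hx y hy i
    rw [hr, h0.geodesicCoeff_randers hx hy]
    simp [projFactor, mix0, contr, sForm, hs, sym00, covDerivForm]

theorem ricciCurv_riem_neg (h : IsRandersOn a b U) (hx : x ∈ U) (hy : y ≠ 0) :
    ricciCurv (riem a) x (-y) = ricciCurv (riem a) x y := by
  rw [h.ricciCurv_riem hx hy, h.ricciCurv_riem hx (neg_ne_zero.2 hy)]
  simp only [baseSpray_neg, baseConn_neg, baseTr_neg, pd_neg, PiLp.neg_apply, neg_mul_neg]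

/-- `∂_i α = α_{y^m} Γ^m_{ik} y^k`: the Levi-Civita connection preserves `α`. -/
theorem pd_base_riem_eq (h : IsRandersOn a b U) (hx : x ∈ U) (hy : y ≠ 0) (i : Fin n) :
    pd i (fun x => riem a x y) x = ∑ m, riemGrad a m x y * baseConn a m i x y := by
  have hα := h.riem_pos hx hy
  have h1 : ∑ m, low a m x y * baseConn a m i x y
      = ∑ l, ∑ k, (∑ m, a x l m * christoffel a m i k x) * (y l * y k) := by
    rw [h.sum_low_mul]
    simp only [baseConn, Finset.mul_sum, Finset.sum_mul]
    refine Finset.sum_congr rfl fun l _ => ?_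
    rw [Finset.sum_comm]
    exact Finset.sum_congr rfl fun k _ => Finset.sum_congr rfl fun m _ => by ring
  have h2 : ∑ l, ∑ k, pd i (fun x => a x k l) x * (y l * y k) = pd i (fun x => quad a x y) x := by
    rw [h.pd_base_quad hx]
    exact Finset.sum_congr rfl fun l _ => Finset.sum_congr rfl fun k _ => by
      rw [h.pd_metric_symm x i k l]; ring
  have h3 : ∑ l, ∑ k, pd k (fun x => a x i l) x * (y l * y k)
      = ∑ l, ∑ k, pd l (fun x => a x i k) x * (y l * y k) := by
    rw [Finset.sum_comm]
    exact Finset.sum_congr rfl fun l _ => Finset.sum_congr rfl fun k _ => by ring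
  have h4 : ∑ m, low a m x y * baseConn a m i x y
      = (1 / 2 : ℝ) * pd i (fun x => quad a x y) x := by
    rw [h1]
    simp only [h.lower_christoffel hx, mul_assoc, ← Finset.mul_sum, sub_mul, add_mul,
      Finset.sum_sub_distrib, Finset.sum_add_distrib]
    rw [h2, h3]; ring
  rw [sum_riemGrad_mul (fun m => baseConn a m i x y), h4, h.pd_base_riem hx hy]
  field_simp

theorem divMix0_eq (h : IsRandersOn a b U) (hx : x ∈ U) (y : Coord n) :
    divMix0 a b x y = ∑ i, pd i (fun x => mix0 a b i x y) x
      + ∑ j, mix0 a b j x y * ∑ i, christoffel a i i j x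
      - ∑ i, ∑ j, baseConn a i j x y * sMix a b j i x := by
  have h1 : ∀ i, pd i (fun x => mix0 a b i x y) x = ∑ p, pd i (sMix a b i p) x * y p := fun i => by
    simp only [mix0]
    rw [pd_sum fun p _ => (h.diff_sMix hx i p).mul_const _]
    exact Finset.sum_congr rfl fun p _ => pd_mul_const (h.diff_sMix hx i p) _
  have h2 : ∑ j, mix0 a b j x y * ∑ i, christoffel a i i j x
      = ∑ k, ∑ p, (∑ m, christoffel a k m k x * sMix a b m p x) * y p := by
    simp only [mix0, Finset.sum_mul, Finset.mul_sum]
    rw [Finset.sum_comm]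
    refine Finset.sum_congr rfl fun k _ => ?_
    rw [Finset.sum_comm]
    refine Finset.sum_congr rfl fun p _ => Finset.sum_congr rfl fun m _ => ?_
    rw [h.christoffel_symm k m k]; ring
  have h3 : ∑ i, ∑ j, baseConn a i j x y * sMix a b j i x
      = ∑ k, ∑ p, (∑ m, christoffel a m p k x * sMix a b k m x) * y p := by
    simp only [baseConn, Finset.sum_mul]
    rw [Finset.sum_comm]
    refine Finset.sum_congr rfl fun k _ => ?_
    rw [Finset.sum_comm]
    refine Finset.sum_congr rfl fun p _ => Finset.sum_congr rfl fun m _ => ?_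
    rw [h.christoffel_symm m p k]; ring
  simp only [divMix0, covDerivEnd, sub_mul, add_mul, Finset.sum_sub_distrib,
    Finset.sum_add_distrib, h1, h2, h3]

/-- `Q^i_{|i} = α s^i_{0|i} - s_{0|0}`, with the horizontal covariant derivative written out. -/
theorem sum_pd_sprayDiff (h : IsRandersOn a b U) (hx : x ∈ U) (hy : y ≠ 0) :
    ∑ i, pd i (fun x => sprayDiff a b i x y) x
      + ∑ j, sprayDiff a b j x y * ∑ i, christoffel a i i j x
      - ∑ i, ∑ j, baseConn a i j x y * sprayDiffGrad a b j i x y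
    = riem a x y * divMix0 a b x y - sym00 a (sForm a b) x y := by
  have dα := h.diff_riem hx hy
  have ds := diff_base_contr (h.diff_sForm hx) y
  have h1 : ∑ i, pd i (fun x => sprayDiff a b i x y) x
      = ∑ i, (∑ m, riemGrad a m x y * baseConn a m i x y) * mix0 a b i x y
        + riem a x y * ∑ i, pd i (fun x => mix0 a b i x y) x
        - ∑ i, y i * pd i (fun x => contr (sForm a b) x y) x := by
    rw [Finset.mul_sum, ← Finset.sum_add_distrib, ← Finset.sum_sub_distrib]
    refine Finset.sum_congr rfl fun i _ => ?_
    have dm := h.diff_mix0 hx i y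
    unfold sprayDiff
    rw [pd_sub (dα.fun_mul dm) (ds.mul_const _), pd_mul dα dm, pd_mul_const ds,
      h.pd_base_riem_eq hx hy]
    ring
  have h2 : ∑ j, sprayDiff a b j x y * ∑ i, christoffel a i i j x
      = riem a x y * ∑ j, mix0 a b j x y * ∑ i, christoffel a i i j x
        - contr (sForm a b) x y * baseTr a x y := by
    rw [← sum_mul_christoffel_self, Finset.mul_sum, Finset.mul_sum, ← Finset.sum_sub_distrib]
    exact Finset.sum_congr rfl fun j _ => by rw [sprayDiff]; ring
  have h3 : ∑ i, ∑ j, baseConn a i j x y * sprayDiffGrad a b j i x y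
      = ∑ i, (∑ m, riemGrad a m x y * baseConn a m i x y) * mix0 a b i x y
        + riem a x y * ∑ i, ∑ j, baseConn a i j x y * sMix a b j i x
        - 2 * ∑ i, sForm a b i x * baseSpray a i x y
        - contr (sForm a b) x y * baseTr a x y := by
    have e1 : ∑ i, (∑ m, riemGrad a m x y * baseConn a m i x y) * mix0 a b i x y
        = ∑ i, ∑ j, baseConn a i j x y * (riemGrad a i x y * mix0 a b j x y) := by
      simp only [Finset.sum_mul]
      rw [Finset.sum_comm]
      exact Finset.sum_congr rfl fun j _ => Finset.sum_congr rfl fun k _ => by ring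
    have e2 : 2 * ∑ i, sForm a b i x * baseSpray a i x y
        = ∑ i, ∑ j, baseConn a i j x y * (sForm a b i x * y j) := by
      rw [Finset.mul_sum]
      refine Finset.sum_congr rfl fun i _ => ?_
      rw [show 2 * (sForm a b i x * baseSpray a i x y)
        = sForm a b i x * (2 * baseSpray a i x y) by ring, ← sum_baseConn_mul_self, Finset.mul_sum]
      exact Finset.sum_congr rfl fun j _ => by ring
    have e3 : contr (sForm a b) x y * baseTr a x y
        = ∑ i, ∑ j, baseConn a i j x y * (contr (sForm a b) x y * (if i = j then 1 else 0)) := by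
      rw [baseTr, Finset.mul_sum]
      refine Finset.sum_congr rfl fun i _ => ?_
      simp [mul_comm]
    have e4 : riem a x y * ∑ i, ∑ j, baseConn a i j x y * sMix a b j i x
        = ∑ i, ∑ j, baseConn a i j x y * (riem a x y * sMix a b j i x) := by
      simp only [Finset.mul_sum]
      exact Finset.sum_congr rfl fun j _ => Finset.sum_congr rfl fun k _ => by ring
    rw [e1, e2, e3, e4]
    simp only [sprayDiffGrad, mul_add, mul_sub, Finset.sum_add_distrib, Finset.sum_sub_distrib]
  rw [h1, h2, h3, h.divMix0_eq hx, sum_pd_base_contr a (h.diff_sForm hx)]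
  ring

/-- `α_{y^j} s^j_i = -s_{i0} / α`. -/
theorem sum_riemGrad_mul_sMix (h : IsRandersOn a b U) (hx : x ∈ U) (i : Fin n) (y : Coord n) :
    ∑ j, riemGrad a j x y * sMix a b j i x = -low0 a b i x y / riem a x y := by
  rw [sum_riemGrad_mul (fun j => sMix a b j i x), h.sum_low_mul]
  congr 1
  simp only [h.lower_sMix hx, low0, ← Finset.sum_neg_distrib]
  exact Finset.sum_congr rfl fun j _ => by rw [sLow_antisymm a b i j]; ring

/-- The trace of the square of `∂Q^i/∂y^k`. -/
theorem sum_sprayDiffGrad_sq (h : IsRandersOn a b U) (hx : x ∈ U) (hy : y ≠ 0) :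
    ∑ i, ∑ j, sprayDiffGrad a b i j x y * sprayDiffGrad a b j i x y
      = ((n : ℝ) + 3) * contr (sForm a b) x y ^ 2
        + riem a x y ^ 2 * ∑ i, ∑ j, sMix a b i j x * sMix a b j i x
        - 4 * riem a x y * ∑ j, sForm a b j x * mix0 a b j x y
        - 2 * ∑ i, low0 a b i x y * mix0 a b i x y := by
  have hα := h.riem_pos hx hy
  -- split off the scalar part: `∂Q^i/∂y^j = X^i_j - s_0 δ^i_j`
  set X : Fin n → Fin n → ℝ := fun i j =>
    riemGrad a j x y * mix0 a b i x y + riem a x y * sMix a b i j x - sForm a b j x * y i with hX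
  set s := contr (sForm a b) x y with hs
  have hXtr : ∑ i, X i i = -s := by
    simp only [hX, Finset.sum_sub_distrib, Finset.sum_add_distrib, ← Finset.mul_sum,
      h.sum_sMix_self, sum_sForm_mul_self]
    rw [sum_riemGrad_mul (fun i => mix0 a b i x y), h.sum_low_mul_mix0 hx]
    simp [hs]
  have h1 : ∑ i, ∑ j, sprayDiffGrad a b i j x y * sprayDiffGrad a b j i x y
      = ∑ i, ∑ j, X i j * X j i - 2 * s * ∑ i, X i i + n * s ^ 2 := by
    have e : ∀ i j, sprayDiffGrad a b i j x y * sprayDiffGrad a b j i x y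
        = X i j * X j i - (if i = j then 2 * s * X i i - s ^ 2 else 0) := fun i j => by
      simp only [sprayDiffGrad, hX, ← hs]
      by_cases hij : i = j
      · subst hij; simp only [if_true]; ring
      · simp only [hij, Ne.symm hij, if_false]; ring
    simp only [e, Finset.sum_sub_distrib, Finset.sum_ite_eq, Finset.mem_univ, if_true,
      ← Finset.mul_sum]
    simp; ring
  set g : Fin n → ℝ := fun i => riemGrad a i x y
  set μ : Fin n → ℝ := fun i => mix0 a b i x y with hμ
  set σ : Fin n → ℝ := fun i => sForm a b i x
  set S : Fin n → Fin n → ℝ := fun i j => sMix a b i j x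
  have e0 : ∑ i, g i * μ i = 0 := by
    change ∑ i, riemGrad a i x y * mix0 a b i x y = 0
    rw [sum_riemGrad_mul (fun i => mix0 a b i x y), h.sum_low_mul_mix0 hx, zero_div]
  have e1 : ∑ i, g i * y i = riem a x y := h.sum_riemGrad_mul_self hx hy
  have e2 : ∑ i, σ i * y i = s := rfl
  have e3 : ∑ i, μ i * ∑ j, g j * S j i = -(∑ i, low0 a b i x y * μ i) / riem a x y := by
    rw [← Finset.sum_neg_distrib, Finset.sum_div]
    refine Finset.sum_congr rfl fun i _ => ?_
    rw [show ∑ j, g j * S j i = _ from h.sum_riemGrad_mul_sMix hx i y]; ring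
  have e4 : ∑ i, σ i * ∑ j, S i j * y j = ∑ i, σ i * μ i := rfl
  have h2 : ∑ i, ∑ j, X i j * X j i
      = (∑ i, g i * μ i) * (∑ i, g i * μ i) + riem a x y ^ 2 * ∑ i, ∑ j, S i j * S j i
        + (∑ i, σ i * y i) * (∑ i, σ i * y i)
        + 2 * riem a x y * ∑ i, μ i * ∑ j, g j * S j i
        - 2 * ((∑ i, σ i * μ i) * ∑ i, g i * y i)
        - 2 * riem a x y * ∑ i, σ i * ∑ j, S i j * y j := by
    have f : ∀ i j, X i j * X j i = (g i * μ i) * (g j * μ j) + riem a x y ^ 2 * (S i j * S j i)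
        + (σ i * y i) * (σ j * y j) + riem a x y * (μ i * (g j * S j i))
        + riem a x y * (μ j * (g i * S i j))
        - (σ i * μ i) * (g j * y j) - (σ j * μ j) * (g i * y i)
        - riem a x y * (σ i * (S i j * y j)) - riem a x y * (σ j * (S j i * y i)) :=
      fun i j => by simp only [hX]; ring
    -- the cross terms agree in pairs after exchanging the two indices
    have c1 : ∑ i, ∑ j, riem a x y * (μ j * (g i * S i j))
        = ∑ i, ∑ j, riem a x y * (μ i * (g j * S j i)) := Finset.sum_comm
    have c2 : ∑ i, ∑ j, (σ j * μ j) * (g i * y i) = ∑ i, ∑ j, (σ i * μ i) * (g j * y j) :=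
      Finset.sum_comm
    have c3 : ∑ i, ∑ j, riem a x y * (σ j * (S j i * y i))
        = ∑ i, ∑ j, riem a x y * (σ i * (S i j * y j)) := Finset.sum_comm
    simp only [f, Finset.sum_add_distrib, Finset.sum_sub_distrib, c1, c2, c3]
    simp only [← Finset.mul_sum, ← Finset.sum_mul]
    ring
  rw [h1, h2, hXtr, e0, e1, e2, e3, e4]
  field_simp
  ring

/-- The Ricci curvature of a Randers metric with `r_{00} = -2 β s_0`. The last term is odd in `y`,
the others are even. -/
theorem ricciCurv_randers (h : IsRandersOn a b U)
    (hr : ∀ x ∈ U, ∀ y : Coord n, y ≠ 0 →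
      sym00 a b x y = -2 * contr b x y * contr (sForm a b) x y) (hx : x ∈ U) (hy : y ≠ 0) :
    ricciCurv (randers a b) x y = ricciCurv (riem a) x y
      + ((n : ℝ) - 1) * (sym00 a (sForm a b) x y + contr (sForm a b) x y ^ 2)
      - riem a x y ^ 2 * ∑ i, ∑ j, sMix a b i j x * sMix a b j i x
      + 2 * ∑ i, low0 a b i x y * mix0 a b i x y
      + 2 * riem a x y *
        (divMix0 a b x y - ((n : ℝ) - 1) * ∑ j, sForm a b j x * mix0 a b j x y) := by
  have ds := diff_base_contr (h.diff_sForm hx) y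
  rw [ricciCurv_of_geodesicCoeff h.isOpen hx hy
    (fun i x y => baseSpray a i x y + sprayDiff a b i x y)
    (fun i k x y => baseConn a i k x y + sprayDiffGrad a b i k x y)
    (fun x y => baseTr a x y + -((n : ℝ) + 1) * contr (sForm a b) x y) ?_ ?_ ?_
    (fun i => (h.diff_baseConn hx i i y).add (h.diff_sprayDiffGrad hx hy i i))
    (fun i => (diff_vert_baseConn a i i x y).add (h.diff_vert_sprayDiffGrad hx hy i i))]
  rotate_left
  · intro x hx y hy i
    rw [h.geodesicCoeff_randers hx hy, h.projFactor_eq hx hy (hr x hx y hy), sprayDiff]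
    ring
  · intro x hx y hy i k
    rw [pd_add (diff_vert_baseSpray a i x y) (h.diff_vert_sprayDiff hx hy i),
      h.pd_vert_baseSpray, h.pd_vert_sprayDiff hx hy]
  · intro x hx y hy
    rw [Finset.sum_add_distrib, h.sum_sprayDiffGrad_self hx, baseTr]
  have t1 : ∑ i, pd i (fun x => baseSpray a i x y + sprayDiff a b i x y) x
      = ∑ i, pd i (fun x => baseSpray a i x y) x + ∑ i, pd i (fun x => sprayDiff a b i x y) x := by
    rw [← Finset.sum_add_distrib]
    exact Finset.sum_congr rfl fun i _ => pd_add (h.diff_baseSpray hx i y)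
      (h.diff_sprayDiff hx hy i)
  have t2 : ∑ j, y j * pd j (fun x => baseTr a x y + -((n : ℝ) + 1) * contr (sForm a b) x y) x
      = ∑ j, y j * pd j (fun x => baseTr a x y) x
        - ((n : ℝ) + 1) * ∑ j, y j * pd j (fun x => contr (sForm a b) x y) x := by
    rw [Finset.mul_sum, ← Finset.sum_sub_distrib]
    refine Finset.sum_congr rfl fun j _ => ?_
    rw [pd_add (h.diff_baseTr hx y) (ds.const_mul _), pd_const_mul ds]
    ring
  have t3 : ∑ j, (baseSpray a j x y + sprayDiff a b j x y)
        * pd j (fun y => baseTr a x y + -((n : ℝ) + 1) * contr (sForm a b) x y) y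
      = ∑ j, baseSpray a j x y * ∑ i, christoffel a i i j x
        + ∑ j, sprayDiff a b j x y * ∑ i, christoffel a i i j x
        - ((n : ℝ) + 1) * (∑ j, sForm a b j x * baseSpray a j x y
          + (riem a x y * ∑ j, sForm a b j x * mix0 a b j x y
            - contr (sForm a b) x y * ∑ j, sForm a b j x * y j)) := by
    have dT : DifferentiableAt ℝ (fun y => baseTr a x y) y :=
      DifferentiableAt.fun_sum fun i _ => diff_vert_baseConn a i i x y
    have dc := diff_vert_contr (sForm a b) x y
    have e : ∀ j, (baseSpray a j x y + sprayDiff a b j x y)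
          * pd j (fun y => baseTr a x y + -((n : ℝ) + 1) * contr (sForm a b) x y) y
        = baseSpray a j x y * ∑ i, christoffel a i i j x
          + sprayDiff a b j x y * ∑ i, christoffel a i i j x
          - ((n : ℝ) + 1) * (sForm a b j x * baseSpray a j x y
            + (riem a x y * (sForm a b j x * mix0 a b j x y)
              - contr (sForm a b) x y * (sForm a b j x * y j))) := fun j => by
      rw [pd_add dT (dc.const_mul _), pd_const_mul dc, pd_vert_baseTr, pd_vert_contr, sprayDiff]
      ring
    simp only [e, Finset.sum_add_distrib, Finset.sum_sub_distrib, ← Finset.mul_sum]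
  have t4 : ∑ i, ∑ j, (baseConn a i j x y + sprayDiffGrad a b i j x y)
        * (baseConn a j i x y + sprayDiffGrad a b j i x y)
      = ∑ i, ∑ j, baseConn a i j x y * baseConn a j i x y
        + 2 * ∑ i, ∑ j, baseConn a i j x y * sprayDiffGrad a b j i x y
        + ∑ i, ∑ j, sprayDiffGrad a b i j x y * sprayDiffGrad a b j i x y := by
    have c : ∑ i, ∑ j, sprayDiffGrad a b i j x y * baseConn a j i x y
        = ∑ i, ∑ j, baseConn a i j x y * sprayDiffGrad a b j i x y := by
      rw [Finset.sum_comm]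
      exact Finset.sum_congr rfl fun i _ => Finset.sum_congr rfl fun j _ => by ring
    simp only [add_mul, mul_add, Finset.sum_add_distrib, c]
    ring
  rw [t1, t2, t3, t4, h.sum_sprayDiffGrad_sq hx hy, h.ricciCurv_riem hx hy, sum_sForm_mul_self,
    sum_pd_base_contr a (h.diff_sForm hx)]
  linear_combination 2 * h.sum_pd_sprayDiff hx hy

/-- A Randers metric of vanishing S-curvature is Ricci-flat at `x` if and only if the odd and the
even part in `y` of its Ricci curvature vanish. -/
theorem ricciCurv_randers_eq_zero_iff (h : IsRandersOn a b U)
    (hS : ∀ x ∈ U, ∀ y : Coord n, y ≠ 0 → SCurv (randers a b) x y = 0) (hx : x ∈ U) :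
    (∀ y : Coord n, y ≠ 0 → ricciCurv (randers a b) x y = 0) ↔ ∀ y : Coord n, y ≠ 0 →
      divMix0 a b x y = ((n : ℝ) - 1) * ∑ j, sForm a b j x * mix0 a b j x y ∧
      ricciCurv (riem a) x y =
        -((n : ℝ) - 1) * (sym00 a (sForm a b) x y + contr (sForm a b) x y ^ 2)
          + riem a x y ^ 2 * ∑ i, ∑ j, sMix a b i j x * sMix a b j i x
          - 2 * ∑ i, low0 a b i x y * mix0 a b i x y := by
  have hr := fun x hx y hy => h.sym00_eq_of_SCurv (x := x) (y := y) hx hy (hS x hx)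
  refine ⟨fun h0 y hy => ?_, fun h0 y hy => ?_⟩
  · have h1 := h0 y hy
    have h2 := h0 (-y) (neg_ne_zero.2 hy)
    rw [h.ricciCurv_randers hr hx hy] at h1
    rw [h.ricciCurv_randers hr hx (neg_ne_zero.2 hy), h.ricciCurv_riem_neg hx hy] at h2
    simp only [riem_neg, contr_neg, sym00_neg, mix0_neg, low0_neg, divMix0_neg, neg_mul,
      mul_neg, neg_neg, Finset.sum_neg_distrib] at h2
    have hα := h.riem_pos hx hy
    constructor
    · apply mul_left_cancel₀ hα.ne'
      linear_combination (h1 - h2) / 4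
    · linear_combination (h1 + h2) / 2
  · obtain ⟨h1, h2⟩ := h0 y hy
    rw [h.ricciCurv_randers hr hx hy]
    linear_combination h2 + 2 * riem a x y * h1

end IsRandersOn

/-! ### Randers metrics on manifolds, read in a chart -/

namespace RandersMetric

variable {M : Type*} [TopologicalSpace M] [ChartedSpace (Coord n) M]
  (e : OpenPartialHomeomorph M (Coord n))

theorem vec_eq_sum (x y : Coord n) :
    vec e x y = ∑ i, y i • vec e x (EuclideanSpace.single i 1) := by
  let T : Coord n →ₗ[ℝ] TangentSpace (𝓡 n) (e.symm x) :=
    { toFun := vec e x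
      map_add' := fun u v => map_add (mfderiv (𝓡 n) (𝓡 n) e.symm x) u v
      map_smul' := fun c v => map_smul (mfderiv (𝓡 n) (𝓡 n) e.symm x) c v }
  change T y = ∑ i, y i • T (EuclideanSpace.single i 1)
  conv_lhs => rw [← sum_smul_single y]
  simp only [map_sum, map_smul]

theorem vec_ne_zero (he : e ∈ IsManifold.maximalAtlas (𝓡 n) ∞ M) {x : Coord n} (hx : x ∈ e.target)
    {y : Coord n} (hy : y ≠ 0) : vec e x y ≠ 0 := by
  have hd : e.MDifferentiable (𝓡 n) (𝓡 n) :=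
    ⟨(contMDiffOn_of_mem_maximalAtlas he).mdifferentiableOn (by simp),
      (contMDiffOn_symm_of_mem_maximalAtlas he).mdifferentiableOn (by simp)⟩
  intro h0
  have h1 := congrArg (fun T => T y) (hd.comp_symm_deriv hx)
  apply hy
  exact h1.symm.trans
    ((congrArg (mfderiv (𝓡 n) (𝓡 n) e (e.symm x)) h0).trans (map_zero _))

variable [IsManifold (𝓡 n) ∞ M] (F : RandersMetric n M)

theorem inner_vec (x y : Coord n) :
    F.metric.inner (e.symm x) (vec e x y) (vec e x y) = quad (F.aCoeff e) x y := by
  rw [vec_eq_sum]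
  simp only [map_sum, map_smul, sum_apply, smul_apply,
    smul_eq_mul, quad, aCoeff, Matrix.of_apply, Finset.mul_sum]
  rw [Finset.sum_comm]
  exact Finset.sum_congr rfl fun i _ => Finset.sum_congr rfl fun j _ => by ring

theorem form_vec (x y : Coord n) :
    F.form (e.symm x) (vec e x y) = contr (F.bCoeff e) x y := by
  rw [vec_eq_sum]
  simp only [map_sum, map_smul, smul_eq_mul, contr, bCoeff]
  exact Finset.sum_congr rfl fun i _ => by ring

theorem alpha_eq : F.alpha e = riem (F.aCoeff e) := by
  funext x y; rw [alpha, inner_vec, riem]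

theorem inChart_eq : F.inChart e = randers (F.aCoeff e) (F.bCoeff e) := by
  funext x y; rw [inChart, form_vec, alpha_eq, randers]

/-- `α + β` is positive off the zero section, by `‖β‖_α < 1` applied to `-v`. The supremum defining
`‖β‖_α` is over a bounded set, since the unit ball of `α` is bounded. -/
theorem form_pos (p : M) (v : TangentSpace (𝓡 n) p) (hv : v ≠ 0) :
    0 < √(F.metric.inner p v v) + F.form p v := by
  obtain ⟨C, hC⟩ : ∃ C : ℝ, ∀ w : TangentSpace (𝓡 n) p,
      F.metric.inner p w w < 1 → |F.form p w| ≤ C := by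
    have h1 := (F.metric.isVonNBounded p).image (F.form p)
    obtain ⟨C, hC⟩ := ((NormedSpace.isVonNBounded_iff ℝ).1 h1).exists_norm_le
    exact ⟨C, fun w hw => hC _ ⟨w, hw, rfl⟩⟩
  have hb : BddAbove (Set.range fun v : {v : TangentSpace (𝓡 n) p // v ≠ 0} =>
      F.form p v.1 / √(F.metric.inner p v.1 v.1)) := by
    refine ⟨2 * C, ?_⟩
    rintro _ ⟨⟨w, hw⟩, rfl⟩
    have hα : 0 < √(F.metric.inner p w w) := Real.sqrt_pos.2 (F.metric.pos p w hw)
    have hsq := Real.sq_sqrt (F.metric.pos p w hw).le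
    set r := √(F.metric.inner p w w)
    -- the vector `w / (2 α(w))` lies in the open unit ball of `α`
    have h1 := hC ((2 * r)⁻¹ • w) (by
      simp only [map_smul, smul_apply, smul_eq_mul, ← hsq]
      have : (2 * r)⁻¹ * ((2 * r)⁻¹ * r ^ 2) = 1 / 4 := by field_simp; norm_num
      rw [this]; norm_num)
    rw [map_smul, smul_eq_mul] at h1
    have h2 := (le_abs_self _).trans h1
    have h3 : (2 * r)⁻¹ * F.form p w = F.form p w / r / 2 := by field_simp
    change F.form p w / r ≤ 2 * C
    linarith
  have hα : 0 < √(F.metric.inner p v v) := Real.sqrt_pos.2 (F.metric.pos p v hv)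
  have h1 := (le_ciSup hb ⟨-v, neg_ne_zero.2 hv⟩).trans_lt (F.norm_lt_one p)
  simp only [map_neg, neg_apply, neg_neg] at h1
  rw [div_lt_one hα] at h1
  linarith

/-- The constant coordinate vector fields of a chart, as sections of the tangent bundle along the
inverse of the chart, are smooth. -/
theorem contMDiffOn_vec (he : e ∈ IsManifold.maximalAtlas (𝓡 n) ∞ M) (v : Coord n) :
    ContMDiffOn (𝓡 n) (𝓡 n).tangent ∞
      (fun x => TotalSpace.mk' (Coord n) (E := fun p : M => TangentSpace (𝓡 n) p)
        (e.symm x) (vec e x v)) e.target := by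
  have h1 : ContMDiffOn (𝓡 n) (𝓡 n) ∞ e.symm e.target :=
    contMDiffOn_symm_of_mem_maximalAtlas he
  have h2 := h1.contMDiffOn_tangentMapWithin (m := ∞) (by simp) e.open_target.uniqueMDiffOn
  have h3 : ContMDiff (𝓡 n) (𝓡 n).tangent ∞
      (fun x : Coord n => (⟨x, v⟩ : TangentBundle (𝓡 n) (Coord n))) := by
    exact fun x => contMDiffWithinAt_vectorSpace_iff_contDiffWithinAt.2 contDiffWithinAt_const
  refine (h2.comp h3.contMDiffOn fun x hx => hx).congr fun x hx => ?_
  simp [tangentMapWithin, vec, mfderivWithin_of_isOpen e.open_target hx]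

theorem contDiffOn_aCoeff (he : e ∈ IsManifold.maximalAtlas (𝓡 n) ∞ M) (i j : Fin n) :
    ContDiffOn ℝ ∞ (fun x => F.aCoeff e x i j) e.target := by
  have h1 : ContMDiffOn (𝓡 n) (𝓡 n) ∞ e.symm e.target :=
    contMDiffOn_symm_of_mem_maximalAtlas he
  have : ContMDiffOn (𝓡 n) ((𝓡 n).prod 𝓘(ℝ)) ∞
      (fun x => TotalSpace.mk' ℝ (E := Bundle.Trivial M ℝ) (e.symm x)
        (F.metric.inner (e.symm x) (vec e x (EuclideanSpace.single i 1))
          (vec e x (EuclideanSpace.single j 1)))) e.target := by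
    apply ContMDiffOn.clm_bundle_apply₂ (F₁ := Coord n) (F₂ := Coord n)
    · exact F.metric.contMDiff.comp_contMDiffOn h1
    · exact contMDiffOn_vec e he _
    · exact contMDiffOn_vec e he _
  intro x hx
  have h2 := this x hx
  simp only [contMDiffWithinAt_totalSpace] at h2
  exact contMDiffWithinAt_iff_contDiffWithinAt.1 h2.2

theorem contDiffOn_bCoeff (he : e ∈ IsManifold.maximalAtlas (𝓡 n) ∞ M) (i : Fin n) :
    ContDiffOn ℝ ∞ (F.bCoeff e i) e.target := by
  have h1 : ContMDiffOn (𝓡 n) (𝓡 n) ∞ e.symm e.target :=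
    contMDiffOn_symm_of_mem_maximalAtlas he
  have : ContMDiffOn (𝓡 n) ((𝓡 n).prod 𝓘(ℝ)) ∞
      (fun x => TotalSpace.mk' ℝ (E := Bundle.Trivial M ℝ) (e.symm x)
        (F.form (e.symm x) (vec e x (EuclideanSpace.single i 1)))) e.target := by
    apply ContMDiffOn.clm_bundle_apply (F₁ := Coord n)
    · exact F.form_smooth.comp_contMDiffOn h1
    · exact contMDiffOn_vec e he _
  intro x hx
  have h2 := this x hx
  simp only [contMDiffWithinAt_totalSpace] at h2
  exact contMDiffWithinAt_iff_contDiffWithinAt.1 h2.2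

theorem isRandersOn (he : e ∈ IsManifold.maximalAtlas (𝓡 n) ∞ M) :
    IsRandersOn (F.aCoeff e) (F.bCoeff e) e.target where
  isOpen := e.open_target
  symm x i j := F.metric.symm _ _ _
  quad_pos x hx y hy := by
    rw [← inner_vec]
    exact F.metric.pos _ _ (vec_ne_zero e he hx hy)
  pos x hx y hy := by
    rw [← inChart_eq]
    exact F.form_pos _ _ (vec_ne_zero e he hx hy)
  contDiffOn_metric i j := (F.contDiffOn_aCoeff e he i j).of_le (by norm_cast)
  contDiffOn_form i := (F.contDiffOn_bCoeff e he i).of_le (by norm_cast)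

end RandersMetric
end Finsler
end

theorem mainTheorem5 {n : ℕ} {M : Type*} [TopologicalSpace M]
    [ChartedSpace (EuclideanSpace ℝ (Fin n)) M] [IsManifold (𝓡 n) ∞ M]
    (F : Finsler.RandersMetric n M) (hS : F.SCurvZero) :
    F.RicciZero ↔
      ∀ e ∈ IsManifold.maximalAtlas (𝓡 n) ∞ M, ∀ x ∈ e.target,
        ∀ y : EuclideanSpace ℝ (Fin n), y ≠ 0 →
          F.divS0 e x y = ((n : ℝ) - 1) * ∑ j, F.sF e j x * F.sM0 e j x y ∧
          Finsler.ricciCurv (F.alpha e) x y =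
            -((n : ℝ) - 1) * (F.s00 e x y + F.s0 e x y ^ 2)
              + F.alpha e x y ^ 2 * ∑ k, ∑ j, F.sM e k j x * F.sM e j k x
              - 2 * ∑ k, F.sL0 e k x y * F.sM0 e k x y := by
  refine forall₂_congr fun e he => forall₂_congr fun x hx => ?_
  have h := F.isRandersOn e he
  have hS' : ∀ x ∈ e.target, ∀ y : Finsler.Coord n, y ≠ 0 →
      Finsler.SCurv (Finsler.randers (F.aCoeff e) (F.bCoeff e)) x y = 0 := by
    rw [← F.inChart_eq]
    exact hS e he
  rw [F.inChart_eq, F.alpha_eq]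
  exact h.ricciCurv_randers_eq_zero_iff hS' hx
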